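/- **Proposition 2.5 (Inflation Principle).** Let $m,n\ge 0$ be integers, let $\Omega\subset\mathbb{C}^n$ be a domain (a non-empty connected open set), let $g$ be a non-vanishing holomorphic function on $\Omega$, and put $\mu=|g|^2$. Let $$\widetilde\Omega=\{(z,w)\in\mathbb{C}^m\times\mathbb{C}^n=\mathbb{C}^{m+n} : w\in\Omega,\ |z|^2<\mu(w)\},$$ where $|z|$ is the Euclidean norm, and let $\lambda$ be a positive continuous function on $\Omega$, regarded also as the function $(z,w)\mapsto\lambda(w)$ on $\widetilde\Omega$. For an open set $D\subset\mathbb{C}^N$ and a positive continuous function $\nu$ on $D$, let $L^p(D,\nu)$ be the space of measurable functions $f$ on $D$ with $\|f\|_{L^p(D,\nu)}=\big(\int_D|f|^p\,\nu\,dV\big)^{1/p}<\infty$ ($dV$ is Lebesgue measure), let $A^2(D,\nu)$ be the closed subspace of $L^2(D,\nu)$ formed by the holomorphic functions on $D$ that belong to $L^2(D,\nu)$, and let the weighted Bergman projection $\mathcal{B}_{D,\nu}$ be the orthogonal projection of $L^2(D,\nu)$ onto $A^2(D,\nu)$. It is called $L^p(D,\nu)$ bounded if there is a constant $C$ such that $\|\mathcal{B}_{D,\nu}f\|_{L^p(D,\nu)}\le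 C\|f\|_{L^p(D,\nu)}$ for all $f\in L^2(D,\nu)\cap L^p(D,\nu)$. Then, for every real $p>1$, the projection $\mathcal{B}_{\widetilde\Omega,\lambda}$ is $L^p(\widetilde\Omega,\lambda)$ bounded if and only if the projection $\mathcal{B}_{\Omega,\mu^m\lambda}$ is $L^p(\Omega,\mu^m\lambda)$ bounded. -/

import Mathlib

open MeasureTheory
open scoped ENNReal NNReal

noncomputable section

namespace WeightedBergman

section General

variable {E : Type*} [NormedAddCommGroup E] [NormedSpace ℂ E] [MeasureSpace E]

/-- The measure `μ dV` on `Ω`, where `dV` is Lebesgue measure; the weighted space `L^p(Ω, μ)` is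
the Lebesgue space of this measure. -/
def weightedMeasure (Ω : Set E) (μ : E → ℝ) : Measure E :=
  (volume.restrict Ω).withDensity fun z => ENNReal.ofReal (μ z)

/-- The weighted Bergman space `A²(Ω, μ) = L²(Ω, μ) ∩ 𝒪(Ω)`: the classes in `L²(Ω, μ)` that have
a representative which is holomorphic on `Ω`. -/
def bergmanSpace (Ω : Set E) (μ : E → ℝ) : Submodule ℂ (Lp ℂ 2 (weightedMeasure Ω μ)) where
  carrier := {f | ∃ F : E → ℂ, DifferentiableOn ℂ F Ω ∧ f =ᵐ[weightedMeasure Ω μ] F}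
  zero_mem' := ⟨0, differentiableOn_const 0, Lp.coeFn_zero _ _ _⟩
  add_mem' := by
    rintro f g ⟨F, hF, hfF⟩ ⟨G, hG, hgG⟩
    exact ⟨F + G, hF.add hG, (Lp.coeFn_add f g).trans (hfF.add hgG)⟩
  smul_mem' := by
    rintro c f ⟨F, hF, hfF⟩
    exact ⟨c • F, hF.const_smul c, (Lp.coeFn_smul c f).trans (hfF.const_smul c)⟩

/-- The weighted Bergman projection: the orthogonal projection of `L²(Ω, μ)` onto `A²(Ω, μ)`, as an
operator on `L²(Ω, μ)`. For a positive continuous weight on an open set `A²(Ω, μ)` is closed, so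
that the closure below is `A²(Ω, μ)` itself; it is written only to have a total definition. -/
def bergmanProjection (Ω : Set E) (μ : E → ℝ) :
    Lp ℂ 2 (weightedMeasure Ω μ) →L[ℂ] Lp ℂ 2 (weightedMeasure Ω μ) :=
  (bergmanSpace Ω μ).topologicalClosure.starProjection

/-- The weighted Bergman projection is `L^p(Ω, μ)` bounded: it satisfies
`‖B f‖_{L^p(Ω, μ)} ≤ C ‖f‖_{L^p(Ω, μ)}` on `L²(Ω, μ) ∩ L^p(Ω, μ)` with a constant `C`, that is, it
extends from this dense subspace to a bounded operator on `L^p(Ω, μ)`. -/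
def IsLpBounded (Ω : Set E) (μ : E → ℝ) (p : ℝ) : Prop :=
  ∃ C : ℝ≥0, ∀ f : Lp ℂ 2 (weightedMeasure Ω μ),
    MemLp f (ENNReal.ofReal p) (weightedMeasure Ω μ) →
      eLpNorm (bergmanProjection Ω μ f) (ENNReal.ofReal p) (weightedMeasure Ω μ) ≤
        C * eLpNorm f (ENNReal.ofReal p) (weightedMeasure Ω μ)

end General

/-- The inflation `{(z, w) ∈ ℂ^m × ℂ^n : |z|² < μ(w), w ∈ Ω}` of `Ω ⊆ ℂ^n` via `μ`, where `|z|` is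
the Euclidean norm. (`ℂ^(m+n)` is written as `ℂ^m × ℂ^n`, with the product Lebesgue measure.) -/
def inflation {n : ℕ} (m : ℕ) (Ω : Set (Fin n → ℂ)) (μ : (Fin n → ℂ) → ℝ) :
    Set ((Fin m → ℂ) × (Fin n → ℂ)) :=
  {x | ∑ i, ‖x.1 i‖ ^ 2 < μ x.2 ∧ x.2 ∈ Ω}

end WeightedBergman

end

noncomputable section

open Filter Topology ComplexConjugate

namespace WeightedBergman

/-! Let `B` be the unit ball of `ℂ^m`. The map `(ζ, w) ↦ (g(w) ζ, w)` is a biholomorphism of `B × Ω`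
onto the inflated domain. On the fibre over `w` its real Jacobian is `|g(w)|^(2m) = μ(w)^m`, so it
carries the product of Lebesgue measure on `B` with `μ^m λ dV` on `Ω` to `λ dV` on the inflation
(`measurePreserving_fiberScaling`). Composition with this map is therefore isometric on `L²` and on
`L^p`, and it preserves holomorphy in both directions, so it intertwines the two Bergman projections
(`IsBergmanProj.comp_measurableEquiv`). What remains is a statement about the product `B × Ω`, where
the projection is the tensor product of the projections of the factors (`IsBergmanProj.tens`).

If the product projection is bounded, apply it to `1 ⊗ f`: the constant `1` is its own projection
because `B` has finite volume, so the bound for `f` follows on dividing by `‖1‖_p`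
(`IsLpBdd.of_prod`). Conversely, bounds on both factors give a bound on finite sums of tensors, one
variable at a time by Tonelli. Such sums are dense in `L²` and `L^p` simultaneously
(`tensApprox_of_memLp`), and Fatou's lemma passes to the limit (`IsLpBdd.of_dense`, `IsLpBdd.prod`).

The analytic input is that the projection of the ball is `L^p` bounded for every `p > 1`
(`isLpBdd_unitBall`). Slicing the ball over the disc of its first coordinate, followed by a
rotation, reduces both the reproducing formula for the Bergman kernel (`integral_mul_ballKernel`)
and the Forelli–Rudin estimate (`exists_lintegral_ballKernel_le`) to the weighted disc. The Schur
test then gives the bound.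

Projections are handled through representatives and onto the closure of the holomorphic classes, so
closedness of the Bergman space is never needed. -/

theorem inner_toLp {X : Type*} [MeasurableSpace X] {ν : Measure X} {f g : X → ℂ}
    (hf : MemLp f 2 ν) (hg : MemLp g 2 ν) :
    inner ℂ (hf.toLp f) (hg.toLp g) = ∫ x, g x * conj (f x) ∂ν := by
  rw [L2.inner_def]
  refine integral_congr_ae ?_
  filter_upwards [hf.coeFn_toLp, hg.coeFn_toLp] with x h1 h2
  rw [h1, h2, RCLike.inner_apply]

/-! ### Bergman projections for representatives and a general measure -/

section Projection

variable {E : Type*} [NormedAddCommGroup E] [NormedSpace ℂ E] [MeasurableSpace E]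

/-- The classes in `L²(ν)` having a representative holomorphic on `Ω`. -/
def holL2 (Ω : Set E) (ν : Measure E) : Submodule ℂ (Lp ℂ 2 ν) where
  carrier := {f | ∃ F : E → ℂ, DifferentiableOn ℂ F Ω ∧ f =ᵐ[ν] F}
  zero_mem' := ⟨0, differentiableOn_const 0, Lp.coeFn_zero _ _ _⟩
  add_mem' := by
    rintro f g ⟨F, hF, hfF⟩ ⟨G, hG, hgG⟩
    exact ⟨F + G, hF.add hG, (Lp.coeFn_add f g).trans (hfF.add hgG)⟩
  smul_mem' := by
    rintro c f ⟨F, hF, hfF⟩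
    exact ⟨c • F, hF.const_smul c, (Lp.coeFn_smul c f).trans (hfF.const_smul c)⟩

/-- `g` represents the orthogonal projection of `f` onto the closure of `holL2 Ω ν`. -/
structure IsBergmanProj (Ω : Set E) (ν : Measure E) (f g : E → ℂ) : Prop where
  left : MemLp f 2 ν
  right : MemLp g 2 ν
  eq : (holL2 Ω ν).topologicalClosure.starProjection (left.toLp f) = right.toLp g

/-- `L^p` boundedness of the Bergman projection, for representatives and a general measure. -/
def IsLpBdd (Ω : Set E) (ν : Measure E) (p : ℝ) : Prop :=
  ∃ C : ℝ≥0, ∀ f g : E → ℂ, IsBergmanProj Ω ν f g → MemLp f (ENNReal.ofReal p) ν →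
    eLpNorm g (ENNReal.ofReal p) ν ≤ C * eLpNorm f (ENNReal.ofReal p) ν

variable {Ω : Set E} {ν : Measure E} {f g f' g' : E → ℂ}

theorem exists_isBergmanProj (Ω : Set E) (hf : MemLp f 2 ν) : ∃ g, IsBergmanProj Ω ν f g :=
  ⟨_, hf, Lp.memLp ((holL2 Ω ν).topologicalClosure.starProjection (hf.toLp f)),
    (Lp.toLp_coeFn _ _).symm⟩

theorem IsBergmanProj.add (h : IsBergmanProj Ω ν f g) (h' : IsBergmanProj Ω ν f' g') :
    IsBergmanProj Ω ν (f + f') (g + g') :=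
  ⟨h.left.add h'.left, h.right.add h'.right, by
    rw [MemLp.toLp_add h.left h'.left, MemLp.toLp_add h.right h'.right, map_add, h.eq, h'.eq]⟩

theorem IsBergmanProj.sub (h : IsBergmanProj Ω ν f g) (h' : IsBergmanProj Ω ν f' g') :
    IsBergmanProj Ω ν (f - f') (g - g') :=
  ⟨h.left.sub h'.left, h.right.sub h'.right, by
    rw [MemLp.toLp_sub h.left h'.left, MemLp.toLp_sub h.right h'.right, map_sub, h.eq, h'.eq]⟩

theorem IsBergmanProj.const_smul (h : IsBergmanProj Ω ν f g) (c : ℂ) :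
    IsBergmanProj Ω ν (c • f) (c • g) :=
  ⟨h.left.const_smul c, h.right.const_smul c, by
    rw [MemLp.toLp_const_smul c h.left, MemLp.toLp_const_smul c h.right, map_smul, h.eq]⟩

theorem IsBergmanProj.zero (Ω : Set E) (ν : Measure E) : IsBergmanProj Ω ν 0 0 :=
  ⟨MemLp.zero, MemLp.zero, by rw [MemLp.toLp_zero, map_zero]⟩

theorem IsBergmanProj.sum {ι : Type*} (s : Finset ι) {f g : ι → E → ℂ}
    (h : ∀ i ∈ s, IsBergmanProj Ω ν (f i) (g i)) :
    IsBergmanProj Ω ν (∑ i ∈ s, f i) (∑ i ∈ s, g i) := by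
  classical
  induction s using Finset.induction_on with
  | empty => simpa using IsBergmanProj.zero Ω ν
  | insert i s hi ih =>
    rw [Finset.sum_insert hi, Finset.sum_insert hi]
    exact (h i (by simp)).add (ih fun j hj => h j (by simp [hj]))

theorem IsBergmanProj.eLpNorm_le (h : IsBergmanProj Ω ν f g) : eLpNorm g 2 ν ≤ eLpNorm f 2 ν := by
  have h1 := (holL2 Ω ν).topologicalClosure.norm_starProjection_apply_le (h.left.toLp f)
  rw [h.eq, Lp.norm_toLp, Lp.norm_toLp] at h1
  exact (ENNReal.toReal_le_toReal h.right.2.ne h.left.2.ne).1 h1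

theorem IsBergmanProj.orth (h : IsBergmanProj Ω ν f g) {F : E → ℂ} (hF : DifferentiableOn ℂ F Ω)
    (hF2 : MemLp F 2 ν) : ∫ x, F x * conj (f x - g x) ∂ν = 0 := by
  have h1 := (holL2 Ω ν).topologicalClosure.starProjection_inner_eq_zero (h.left.toLp f)
    (hF2.toLp F) ((holL2 Ω ν).le_topologicalClosure ⟨F, hF, hF2.coeFn_toLp⟩)
  rwa [h.eq, ← MemLp.toLp_sub h.left h.right, inner_toLp] at h1

theorem IsBergmanProj.approx (h : IsBergmanProj Ω ν f g) : ∃ F : ℕ → E → ℂ,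
    (∀ k, DifferentiableOn ℂ (F k) Ω) ∧ (∀ k, MemLp (F k) 2 ν) ∧
      Tendsto (fun k => eLpNorm (F k - g) 2 ν) atTop (𝓝 0) := by
  have h1 : h.right.toLp g ∈ closure (holL2 Ω ν : Set (Lp ℂ 2 ν)) := by
    rw [← h.eq, ← Submodule.topologicalClosure_coe]
    exact Submodule.starProjection_apply_mem _ _
  obtain ⟨u, hu, hlim⟩ := mem_closure_iff_seq_limit.1 h1
  choose F hF huF using hu
  have hF2 : ∀ k, MemLp (F k) 2 ν := fun k => (memLp_congr_ae (huF k)).1 (Lp.memLp (u k))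
  refine ⟨F, hF, hF2, (Lp.tendsto_Lp_iff_tendsto_eLpNorm'' F hF2 g h.right).1 ?_⟩
  convert hlim using 2 with k
  rw [← Lp.toLp_coeFn (u k) (Lp.memLp _)]
  exact (MemLp.toLp_eq_toLp_iff _ _).2 (huF k).symm

/-- Being an `L²` limit of holomorphic functions and leaving a remainder orthogonal to the
holomorphic ones characterises the projection onto the closure, since a subspace and its closure
have the same orthogonal complement. With `approx` and `orth` as the converse, later arguments use
only these two properties. -/
theorem IsBergmanProj.of_approx_orth (hf : MemLp f 2 ν) (hg : MemLp g 2 ν)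
    (F : ℕ → E → ℂ) (hF : ∀ k, DifferentiableOn ℂ (F k) Ω) (hF2 : ∀ k, MemLp (F k) 2 ν)
    (hlim : Tendsto (fun k => eLpNorm (F k - g) 2 ν) atTop (𝓝 0))
    (horth : ∀ G, DifferentiableOn ℂ G Ω → MemLp G 2 ν → ∫ x, G x * conj (f x - g x) ∂ν = 0) :
    IsBergmanProj Ω ν f g := by
  refine ⟨hf, hg, Submodule.eq_starProjection_of_mem_orthogonal ?_ ?_⟩
  · rw [← SetLike.mem_coe, Submodule.topologicalClosure_coe]
    refine mem_closure_iff_seq_limit.2 ⟨fun k => (hF2 k).toLp (F k), fun k =>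
      ⟨F k, hF k, (hF2 k).coeFn_toLp⟩, (Lp.tendsto_Lp_iff_tendsto_eLpNorm'' F hF2 g hg).2 hlim⟩
  · rw [Submodule.orthogonal_closure, Submodule.mem_orthogonal']
    rintro u ⟨G, hG, huG⟩
    have hG2 : MemLp G 2 ν := (memLp_congr_ae huG).1 (Lp.memLp u)
    have hu : u = hG2.toLp G := by
      rw [← Lp.toLp_coeFn u (Lp.memLp _)]
      exact (MemLp.toLp_eq_toLp_iff _ _).2 huG
    rw [hu, ← MemLp.toLp_sub hf hg, inner_toLp]
    exact horth G hG hG2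

/-- The Fatou argument: `L^p` boundedness of the projection may be checked on functions that are
dense in `L²` and `L^p` simultaneously. -/
theorem IsLpBdd.of_dense {p : ℝ} (hp : 1 < p) (D : Set (E → ℂ)) (C : ℝ≥0)
    (hD : ∀ f, MemLp f 2 ν → MemLp f (ENNReal.ofReal p) ν → ∃ u : ℕ → E → ℂ, (∀ k, u k ∈ D) ∧
      (∀ k, MemLp (u k) 2 ν) ∧ (∀ k, MemLp (u k) (ENNReal.ofReal p) ν) ∧
      Tendsto (fun k => eLpNorm (u k - f) 2 ν) atTop (𝓝 0) ∧
      Tendsto (fun k => eLpNorm (u k - f) (ENNReal.ofReal p) ν) atTop (𝓝 0))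
    (hC : ∀ f ∈ D, MemLp f 2 ν → MemLp f (ENNReal.ofReal p) ν → ∃ g, IsBergmanProj Ω ν f g ∧
      eLpNorm g (ENNReal.ofReal p) ν ≤ C * eLpNorm f (ENNReal.ofReal p) ν) :
    IsLpBdd Ω ν p := by
  have hp1 : 1 ≤ ENNReal.ofReal p := by simpa using hp.le
  refine ⟨C, fun f g hfg hf => ?_⟩
  obtain ⟨u, huD, hu2, hup, hl2, hlp⟩ := hD f hfg.left hf
  choose v hv hvC using fun k => hC (u k) (huD k) (hu2 k) (hup k)
  -- The projection contracts the `L²` norm, so the images converge in `L²`, and a subsequence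
  -- converges almost everywhere. Fatou then needs nothing about convergence of the images in `L^p`.
  have hvl : Tendsto (fun k => eLpNorm (v k - g) 2 ν) atTop (𝓝 0) :=
    tendsto_of_tendsto_of_tendsto_of_le_of_le tendsto_const_nhds hl2 (fun _ => zero_le)
      fun k => ((hv k).sub hfg).eLpNorm_le
  obtain ⟨ns, hns, hae⟩ := (tendstoInMeasure_of_tendsto_eLpNorm two_ne_zero
    (fun k => (hv k).right.1) hfg.right.1 hvl).exists_seq_tendsto_ae
  refine (Lp.eLpNorm_lim_le_liminf_eLpNorm (fun k => (hv (ns k)).right.1) g hae).trans ?_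
  have hb : ∀ k, eLpNorm (v (ns k)) (ENNReal.ofReal p) ν ≤
      C * (eLpNorm (u (ns k) - f) (ENNReal.ofReal p) ν + eLpNorm f (ENNReal.ofReal p) ν) := by
    intro k
    refine (hvC _).trans ?_
    gcongr
    calc eLpNorm (u (ns k)) (ENNReal.ofReal p) ν
        = eLpNorm (u (ns k) - f + f) (ENNReal.ofReal p) ν := by rw [sub_add_cancel]
      _ ≤ _ := eLpNorm_add_le ((hu2 _).1.sub hf.1) hf.1 hp1
  have hlim : Tendsto (fun k => (C : ℝ≥0∞) *
      (eLpNorm (u (ns k) - f) (ENNReal.ofReal p) ν + eLpNorm f (ENNReal.ofReal p) ν)) atTop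
      (𝓝 (C * (0 + eLpNorm f (ENNReal.ofReal p) ν))) :=
    ENNReal.Tendsto.const_mul ((hlp.comp hns.tendsto_atTop).add_const _) (Or.inr ENNReal.coe_ne_top)
  calc _ ≤ liminf (fun k => (C : ℝ≥0∞) *
      (eLpNorm (u (ns k) - f) (ENNReal.ofReal p) ν + eLpNorm f (ENNReal.ofReal p) ν)) atTop :=
        liminf_le_liminf (Eventually.of_forall hb)
    _ = _ := by rw [hlim.liminf_eq, zero_add]

end Projection

theorem isLpBounded_iff_isLpBdd {E : Type*} [NormedAddCommGroup E] [NormedSpace ℂ E]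
    [MeasureSpace E] (Ω : Set E) (μ : E → ℝ) (p : ℝ) :
    IsLpBounded Ω μ p ↔ IsLpBdd Ω (weightedMeasure Ω μ) p := by
  constructor
  · rintro ⟨C, hC⟩
    refine ⟨C, fun f g hfg hf => ?_⟩
    have h := hC (hfg.left.toLp f) ((memLp_congr_ae hfg.left.coeFn_toLp).2 hf)
    have e : bergmanProjection Ω μ (hfg.left.toLp f) = hfg.right.toLp g := hfg.eq
    rw [e] at h
    rwa [eLpNorm_congr_ae hfg.left.coeFn_toLp, eLpNorm_congr_ae hfg.right.coeFn_toLp] at h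
  · rintro ⟨C, hC⟩
    refine ⟨C, fun f hf => hC f _ ⟨Lp.memLp f, Lp.memLp _, ?_⟩ hf⟩
    rw [Lp.toLp_coeFn, Lp.toLp_coeFn]
    rfl

/-! ### Invariance under biholomorphic measure isomorphisms -/

section Transfer

variable {E E' : Type*} [NormedAddCommGroup E] [NormedSpace ℂ E] [MeasurableSpace E]
  [NormedAddCommGroup E'] [NormedSpace ℂ E'] [MeasurableSpace E']
  {Ω : Set E} {Ω' : Set E'} {ν : Measure E} {ν' : Measure E'}

/-- Composition with `Φ` is a unitary map of the `L²` spaces, and it matches the holomorphic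
functions because `Φ` and its inverse are both holomorphic. No Jacobian factor appears, since the
measures themselves correspond. -/
theorem IsBergmanProj.comp_measurableEquiv (Φ : E ≃ᵐ E') (hΦ : MeasurePreserving Φ ν ν')
    (hd : DifferentiableOn ℂ Φ Ω) (hd' : DifferentiableOn ℂ Φ.symm Ω') (hm : Set.MapsTo Φ Ω Ω')
    (hm' : Set.MapsTo Φ.symm Ω' Ω) {f g : E' → ℂ} (h : IsBergmanProj Ω' ν' f g) :
    IsBergmanProj Ω ν (f ∘ Φ) (g ∘ Φ) := by
  obtain ⟨F, hF, hF2, hlim⟩ := h.approx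
  refine .of_approx_orth (h.left.comp_measurePreserving hΦ) (h.right.comp_measurePreserving hΦ)
    (fun k => F k ∘ Φ) (fun k => (hF k).comp hd hm)
    (fun k => (hF2 k).comp_measurePreserving hΦ) ?_ ?_
  · convert hlim using 2 with k
    exact eLpNorm_comp_measurePreserving ((hF2 k).1.sub h.right.1) hΦ
  · intro G hG hG2
    have h1 := h.orth (hG.comp hd' hm') (hG2.comp_measurePreserving (hΦ.symm Φ))
    rw [← hΦ.integral_comp Φ.measurableEmbedding] at h1
    simpa using h1

theorem IsLpBdd.of_measurableEquiv (Φ : E ≃ᵐ E') (hΦ : MeasurePreserving Φ ν ν')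
    (hd : DifferentiableOn ℂ Φ Ω) (hd' : DifferentiableOn ℂ Φ.symm Ω') (hm : Set.MapsTo Φ Ω Ω')
    (hm' : Set.MapsTo Φ.symm Ω' Ω) {p : ℝ} (h : IsLpBdd Ω ν p) : IsLpBdd Ω' ν' p := by
  obtain ⟨C, hC⟩ := h
  refine ⟨C, fun f g hfg hf => ?_⟩
  have := hC _ _ (hfg.comp_measurableEquiv Φ hΦ hd hd' hm hm') (hf.comp_measurePreserving hΦ)
  rwa [eLpNorm_comp_measurePreserving hf.1 hΦ,
    eLpNorm_comp_measurePreserving hfg.right.1 hΦ] at this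

theorem isLpBdd_iff_of_measurableEquiv (Φ : E ≃ᵐ E') (hΦ : MeasurePreserving Φ ν ν')
    (hd : DifferentiableOn ℂ Φ Ω) (hd' : DifferentiableOn ℂ Φ.symm Ω') (hm : Set.MapsTo Φ Ω Ω')
    (hm' : Set.MapsTo Φ.symm Ω' Ω) {p : ℝ} : IsLpBdd Ω ν p ↔ IsLpBdd Ω' ν' p :=
  ⟨.of_measurableEquiv Φ hΦ hd hd' hm hm',
    .of_measurableEquiv Φ.symm (hΦ.symm Φ) hd' (by simpa using hd) hm' (by simpa using hm)⟩

end Transfer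

/-! ### Density of sums of products, in two exponents at once -/

section Tensor

variable {X Y : Type*} [MeasurableSpace X] [MeasurableSpace Y] {α : Measure X} {β : Measure Y}

/-- The function `(x, y) ↦ a x * b y`. -/
def tens (a : X → ℂ) (b : Y → ℂ) : X × Y → ℂ := fun z => a z.1 * b z.2

theorem aestronglyMeasurable_tens [SFinite β] {a : X → ℂ} {b : Y → ℂ}
    (ha : AEStronglyMeasurable a α) (hb : AEStronglyMeasurable b β) :
    AEStronglyMeasurable (tens a b) (α.prod β) :=
  ha.comp_fst.mul hb.comp_snd

theorem eLpNorm_tens [SFinite β] {a : X → ℂ} {b : Y → ℂ} (ha : AEStronglyMeasurable a α)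
    (hb : AEStronglyMeasurable b β) {q : ℝ≥0∞} (hq : q ≠ 0) (hq' : q ≠ ∞) :
    eLpNorm (tens a b) q (α.prod β) = eLpNorm a q α * eLpNorm b q β := by
  simp only [eLpNorm_eq_lintegral_rpow_enorm_toReal hq hq', tens, enorm_mul,
    ENNReal.mul_rpow_of_nonneg _ _ ENNReal.toReal_nonneg]
  rw [lintegral_prod_mul (f := fun x => ‖a x‖ₑ ^ q.toReal) (g := fun y => ‖b y‖ₑ ^ q.toReal)
    (ha.enorm.pow_const _) (hb.enorm.pow_const _), ENNReal.mul_rpow_of_nonneg _ _ (by positivity)]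

theorem memLp_tens [SFinite β] {a : X → ℂ} {b : Y → ℂ} {q : ℝ≥0∞} (ha : MemLp a q α)
    (hb : MemLp b q β) (hq : q ≠ 0) (hq' : q ≠ ∞) : MemLp (tens a b) q (α.prod β) :=
  ⟨aestronglyMeasurable_tens ha.1 hb.1, by
    rw [eLpNorm_tens ha.1 hb.1 hq hq']; exact ENNReal.mul_lt_top ha.2 hb.2⟩

theorem ae_memLp_slice_left [SFinite α] [SFinite β] {G : X × Y → ℂ}
    (hG : MemLp G 2 (α.prod β)) : ∀ᵐ y ∂β, MemLp (fun x => G (x, y)) 2 α := by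
  have h1 := ((memLp_two_iff_integrable_sq_norm hG.1).1 hG).prod_left_ae
  filter_upwards [h1, hG.1.prodMk_right] with y hy hm
  exact (memLp_two_iff_integrable_sq_norm hm).2 hy

theorem ae_memLp_slice_right [SFinite α] [SFinite β] {G : X × Y → ℂ}
    (hG : MemLp G 2 (α.prod β)) : ∀ᵐ x ∂α, MemLp (fun y => G (x, y)) 2 β := by
  have h1 := ((memLp_two_iff_integrable_sq_norm hG.1).1 hG).prod_right_ae
  filter_upwards [h1, hG.1.prodMk_left] with x hx hm
  exact (memLp_two_iff_integrable_sq_norm hm).2 hx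

theorem integrable_mul_conj {ν : Measure X} {f g : X → ℂ} (hf : MemLp f 2 ν)
    (hg : MemLp g 2 ν) : Integrable (fun x => f x * conj (g x)) ν :=
  hf.integrable_mul hg.star

/-- Simultaneous approximability in `L²` and `L^q` by finite sums of products. -/
def TensApprox (α : Measure X) (β : Measure Y) (q : ℝ≥0∞) (f : X × Y → ℂ) : Prop :=
  ∀ ε : ℝ≥0∞, ε ≠ 0 → ∃ u ∈ Submodule.span ℂ {u : X × Y → ℂ | ∃ a b, u = tens a b ∧ MemLp a 2 α ∧
    MemLp a q α ∧ MemLp b 2 β ∧ MemLp b q β},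
      eLpNorm (u - f) 2 (α.prod β) ≤ ε ∧ eLpNorm (u - f) q (α.prod β) ≤ ε

variable {q : ℝ≥0∞}

theorem tensApprox_tens {a : X → ℂ} {b : Y → ℂ} (ha : MemLp a 2 α) (ha' : MemLp a q α)
    (hb : MemLp b 2 β) (hb' : MemLp b q β) : TensApprox α β q (tens a b) := fun ε _ =>
  ⟨tens a b, Submodule.subset_span ⟨a, b, rfl, ha, ha', hb, hb'⟩, by simp⟩

theorem tensApprox_zero : TensApprox α β q 0 := fun ε _ => ⟨0, zero_mem _, by simp⟩

theorem TensApprox.const_smul {f : X × Y → ℂ} (hf : TensApprox α β q f) (c : ℂ) :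
    TensApprox α β q (c • f) := by
  intro ε hε
  -- The extra `1` makes `c = 0` an ordinary case.
  obtain ⟨u, hu, hu2, huq⟩ := hf (ε / (‖c‖ₑ + 1))
    (ENNReal.div_ne_zero.2 ⟨hε, by simp⟩)
  have hb : ‖c‖ₑ * (ε / (‖c‖ₑ + 1)) ≤ ε := by
    calc ‖c‖ₑ * (ε / (‖c‖ₑ + 1)) ≤ (‖c‖ₑ + 1) * (ε / (‖c‖ₑ + 1)) := by gcongr; exact le_self_add
      _ ≤ ε := ENNReal.mul_div_le
  refine ⟨c • u, Submodule.smul_mem _ c hu, ?_, ?_⟩ <;>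
    rw [← smul_sub, eLpNorm_const_smul] <;> refine le_trans ?_ hb <;> gcongr

variable [SFinite β]

theorem memLp_of_mem_span_tens (hq : q ≠ 0) (hq' : q ≠ ∞) {u : X × Y → ℂ}
    (hu : u ∈ Submodule.span ℂ {u : X × Y → ℂ | ∃ a b, u = tens a b ∧ MemLp a 2 α ∧
      MemLp a q α ∧ MemLp b 2 β ∧ MemLp b q β}) :
    MemLp u 2 (α.prod β) ∧ MemLp u q (α.prod β) := by
  induction hu using Submodule.span_induction with
  | mem u hu =>
    obtain ⟨a, b, rfl, ha, ha', hb, hb'⟩ := hu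
    exact ⟨memLp_tens ha hb (by simp) (by simp), memLp_tens ha' hb' hq hq'⟩
  | zero => exact ⟨MemLp.zero, MemLp.zero⟩
  | add u v _ _ hu hv => exact ⟨hu.1.add hv.1, hu.2.add hv.2⟩
  | smul c u _ hu => exact ⟨hu.1.const_smul c, hu.2.const_smul c⟩

theorem TensApprox.add (hq1 : 1 ≤ q) (hq' : q ≠ ∞) {f g : X × Y → ℂ}
    (hfm : AEStronglyMeasurable f (α.prod β)) (hgm : AEStronglyMeasurable g (α.prod β))
    (hf : TensApprox α β q f) (hg : TensApprox α β q g) : TensApprox α β q (f + g) := by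
  intro ε hε
  have hq : q ≠ 0 := (zero_lt_one.trans_le hq1).ne'
  obtain ⟨u, hu, hu2, huq⟩ := hf (ε / 2) (by simpa using hε)
  obtain ⟨v, hv, hv2, hvq⟩ := hg (ε / 2) (by simpa using hε)
  have hum := (memLp_of_mem_span_tens hq hq' hu).1.1
  have hvm := (memLp_of_mem_span_tens hq hq' hv).1.1
  have e : u + v - (f + g) = (u - f) + (v - g) := by ring
  refine ⟨u + v, add_mem hu hv, ?_, ?_⟩ <;> rw [e, ← ENNReal.add_halves ε]
  · exact (eLpNorm_add_le (hum.sub hfm) (hvm.sub hgm) one_le_two).trans (by gcongr)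
  · exact (eLpNorm_add_le (hum.sub hfm) (hvm.sub hgm) hq1).trans (by gcongr)

theorem TensApprox.sum (hq1 : 1 ≤ q) (hq' : q ≠ ∞) {ι : Type*} (s : Finset ι)
    {f : ι → X × Y → ℂ} (hfm : ∀ i ∈ s, AEStronglyMeasurable (f i) (α.prod β))
    (hf : ∀ i ∈ s, TensApprox α β q (f i)) : TensApprox α β q (∑ i ∈ s, f i) := by
  classical
  induction s using Finset.induction_on with
  | empty => simpa using tensApprox_zero
  | insert i s hi ih =>
    rw [Finset.sum_insert hi]
    exact .add hq1 hq' (hfm i (by simp))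
      (Finset.aestronglyMeasurable_sum s fun j hj => hfm j (by simp [hj])) (hf i (by simp))
      (ih (fun j hj => hfm j (by simp [hj])) fun j hj => hf j (by simp [hj]))

theorem TensApprox.of_tendsto (hq1 : 1 ≤ q) (hq' : q ≠ ∞) {f : X × Y → ℂ} {u : ℕ → X × Y → ℂ}
    (hfm : AEStronglyMeasurable f (α.prod β)) (hum : ∀ k, AEStronglyMeasurable (u k) (α.prod β))
    (hu : ∀ k, TensApprox α β q (u k))
    (h2 : Tendsto (fun k => eLpNorm (u k - f) 2 (α.prod β)) atTop (𝓝 0))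
    (hq : Tendsto (fun k => eLpNorm (u k - f) q (α.prod β)) atTop (𝓝 0)) :
    TensApprox α β q f := by
  intro ε hε
  have hε2 : 0 < ε / 2 := ENNReal.half_pos hε
  obtain ⟨k, hk2, hkq⟩ := ((h2.eventually (gt_mem_nhds hε2)).and
    (hq.eventually (gt_mem_nhds hε2))).exists
  obtain ⟨v, hv, hv2, hvq⟩ := hu k (ε / 2) hε2.ne'
  have hvm := (memLp_of_mem_span_tens (zero_lt_one.trans_le hq1).ne' hq' hv).1.1
  have e : v - f = (v - u k) + (u k - f) := by ring
  refine ⟨v, hv, ?_, ?_⟩ <;> rw [e, ← ENNReal.add_halves ε]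
  · exact (eLpNorm_add_le (hvm.sub (hum k)) ((hum k).sub hfm) one_le_two).trans
      (add_le_add hv2 hk2.le)
  · exact (eLpNorm_add_le (hvm.sub (hum k)) ((hum k).sub hfm) hq1).trans
      (add_le_add hvq hkq.le)

/-- The norm of the difference is a positive power of the measure of the part not yet covered, which
tends to zero by continuity from above. This is where the finiteness of the measure of the union
enters. -/
theorem tendsto_eLpNorm_indicator_sub_iUnion {Z : Type*} [MeasurableSpace Z] {ν : Measure Z}
    {S : ℕ → Set Z} (hS : ∀ n, MeasurableSet (S n)) (hmono : Monotone S)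
    (hfin : ν (⋃ n, S n) ≠ ∞) {r : ℝ≥0∞} (hr : r ≠ 0) (hr' : r ≠ ∞) :
    Tendsto (fun n => eLpNorm ((S n).indicator (1 : Z → ℂ) - (⋃ n, S n).indicator 1) r ν)
      atTop (𝓝 0) := by
  have e : ∀ n, eLpNorm ((S n).indicator (1 : Z → ℂ) - (⋃ n, S n).indicator 1) r ν =
      ν ((⋃ n, S n) \ S n) ^ (1 / r.toReal) := by
    intro n
    have h1 : (S n).indicator (1 : Z → ℂ) - (⋃ n, S n).indicator 1 =
        ((⋃ n, S n) \ S n).indicator (fun _ => (-1 : ℂ)) := by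
      ext z
      have hsub : z ∈ S n → z ∈ ⋃ n, S n := fun h => Set.mem_iUnion.2 ⟨n, h⟩
      by_cases hz : z ∈ S n
      · simp [Set.indicator, hz, hsub hz]
      · by_cases hz' : z ∈ ⋃ n, S n <;>
          simp only [Set.indicator, Pi.sub_apply, Set.mem_sdiff, hz, hz'] <;> simp
    rw [h1, eLpNorm_indicator_const ((MeasurableSet.iUnion hS).diff (hS n)) hr hr']
    simp
  simp_rw [e]
  have h0 : Tendsto (fun n => ν ((⋃ n, S n) \ S n)) atTop (𝓝 0) := by
    have h1 := tendsto_measure_iInter_atTop (μ := ν) (s := fun n => (⋃ n, S n) \ S n)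
      (fun n => ((MeasurableSet.iUnion hS).diff (hS n)).nullMeasurableSet)
      (fun i j hij => Set.sdiff_subset_sdiff_right (hmono hij))
      ⟨0, ne_top_of_le_ne_top hfin (measure_mono Set.sdiff_subset)⟩
    rwa [← Set.sdiff_iUnion, Set.sdiff_self, measure_empty] at h1
  have hpos : 0 < 1 / r.toReal := one_div_pos.2 (ENNReal.toReal_pos hr hr')
  have h2 := ((ENNReal.continuous_rpow_const (y := 1 / r.toReal)).tendsto 0).comp h0
  rwa [ENNReal.zero_rpow_of_pos hpos] at h2

/-- A π-λ argument starting from rectangles. Intersecting with a box of finite measure keeps every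
indicator integrable, so that complements can be taken inside the box and increasing unions converge
in norm. -/
theorem tensApprox_indicator_inter (hq1 : 1 ≤ q) (hq' : q ≠ ∞) {U : Set X} {T : Set Y}
    (hU : MeasurableSet U) (hT : MeasurableSet T) (hUf : α U ≠ ∞) (hTf : β T ≠ ∞)
    {S : Set (X × Y)} (hS : MeasurableSet S) :
    TensApprox α β q ((S ∩ U ×ˢ T).indicator 1) := by
  have hq : q ≠ 0 := (zero_lt_one.trans_le hq1).ne'
  have hm : ∀ S : Set (X × Y), MeasurableSet S →
      AEStronglyMeasurable ((S ∩ U ×ˢ T).indicator (1 : X × Y → ℂ)) (α.prod β) := fun S hS =>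
    aestronglyMeasurable_one.indicator (hS.inter (hU.prod hT))
  have hrect : ∀ A B, MeasurableSet A → MeasurableSet B →
      TensApprox α β q (((A ×ˢ B) ∩ U ×ˢ T).indicator 1) := by
    intro A B hA hB
    have e : ((A ×ˢ B) ∩ U ×ˢ T).indicator (1 : X × Y → ℂ) =
        tens ((A ∩ U).indicator fun _ => 1) ((B ∩ T).indicator fun _ => 1) := by
      ext ⟨x, y⟩
      rw [Set.prod_inter_prod]
      by_cases h1 : x ∈ A ∩ U <;> by_cases h2 : y ∈ B ∩ T <;> simp [tens, Set.indicator, h1, h2]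
    rw [e]
    have h1 : α (A ∩ U) ≠ ∞ := ne_top_of_le_ne_top hUf (measure_mono Set.inter_subset_right)
    have h2 : β (B ∩ T) ≠ ∞ := ne_top_of_le_ne_top hTf (measure_mono Set.inter_subset_right)
    exact tensApprox_tens (memLp_indicator_const _ (hA.inter hU) _ (Or.inr h1))
      (memLp_indicator_const _ (hA.inter hU) _ (Or.inr h1))
      (memLp_indicator_const _ (hB.inter hT) _ (Or.inr h2))
      (memLp_indicator_const _ (hB.inter hT) _ (Or.inr h2))
  induction S, hS using MeasurableSpace.induction_on_inter generateFrom_prod.symm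
    isPiSystem_prod with
  | empty =>
    rw [Set.empty_inter, Set.indicator_empty]
    exact tensApprox_zero
  | basic S hS =>
    obtain ⟨A, hA, B, hB, rfl⟩ := hS
    exact hrect A B hA hB
  | compl S hS ih =>
    have e : (Sᶜ ∩ U ×ˢ T).indicator (1 : X × Y → ℂ) =
        ((Set.univ ×ˢ Set.univ) ∩ U ×ˢ T).indicator 1 + (-1 : ℂ) • (S ∩ U ×ˢ T).indicator 1 := by
      ext z
      by_cases h1 : z ∈ S <;> by_cases h2 : z ∈ U ×ˢ T <;>
        simp only [Set.indicator, Set.mem_inter_iff, Set.mem_compl_iff, h1, h2, Pi.add_apply,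
          Pi.smul_apply, Pi.one_apply, Set.univ_prod_univ, Set.mem_univ] <;> simp
    rw [e]
    exact .add hq1 hq' (hm _ (MeasurableSet.univ.prod MeasurableSet.univ)) ((hm S hS).const_smul _)
      (hrect _ _ .univ .univ) (ih.const_smul _)
  | iUnion f hd hf ih =>
    set R : ℕ → Set (X × Y) := fun n => (⋃ i ∈ Finset.range n, f i) ∩ U ×ˢ T with hR
    have hRm : ∀ n, MeasurableSet (R n) := fun n =>
      (Finset.measurableSet_biUnion _ fun i _ => hf i).inter (hU.prod hT)
    have hmono : Monotone R := fun i j hij => Set.inter_subset_inter_left _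
      (Set.biUnion_subset_biUnion_left fun k hk =>
        Finset.mem_coe.2 (Finset.range_subset_range.2 hij hk))
    have hU' : (⋃ i, f i) ∩ U ×ˢ T = ⋃ n, R n := by
      rw [hR, ← Set.iUnion_inter]
      congr 1
      ext z
      simp only [Set.mem_iUnion, Finset.mem_range]
      exact ⟨fun ⟨i, hi⟩ => ⟨i + 1, i, by simp, hi⟩, fun ⟨n, i, _, hi⟩ => ⟨i, hi⟩⟩
    have hfin : (α.prod β) (⋃ n, R n) ≠ ∞ := by
      rw [← hU']
      refine ne_top_of_le_ne_top ?_ (measure_mono Set.inter_subset_right)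
      rw [Measure.prod_prod]
      exact ENNReal.mul_ne_top hUf hTf
    have hsum : ∀ n, (R n).indicator (1 : X × Y → ℂ) =
        ∑ i ∈ Finset.range n, (f i ∩ U ×ˢ T).indicator 1 := by
      intro n
      rw [hR]
      simp only [Set.iUnion_inter]
      rw [Finset.indicator_biUnion]
      · ext z; simp
      · exact fun i _ j _ hij => (hd hij).mono Set.inter_subset_left Set.inter_subset_left
    rw [hU']
    refine .of_tendsto hq1 hq' (u := fun n => (R n).indicator 1)
      (aestronglyMeasurable_one.indicator (.iUnion hRm))
      (fun n => aestronglyMeasurable_one.indicator (hRm n)) (fun n => ?_)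
      (tendsto_eLpNorm_indicator_sub_iUnion hRm hmono hfin (by simp) (by simp))
      (tendsto_eLpNorm_indicator_sub_iUnion hRm hmono hfin hq hq')
    rw [hsum]
    exact .sum hq1 hq' _ (fun i _ => hm _ (hf i)) fun i _ => ih i

theorem tensApprox_indicator {α : Measure X} {β : Measure Y} [SigmaFinite α] [SigmaFinite β]
    (hq1 : 1 ≤ q) (hq' : q ≠ ∞) {S : Set (X × Y)}
    (hS : MeasurableSet S) (hSf : (α.prod β) S ≠ ∞) : TensApprox α β q (S.indicator 1) := by
  have hq : q ≠ 0 := (zero_lt_one.trans_le hq1).ne'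
  set R : ℕ → Set (X × Y) := fun n => S ∩ spanningSets α n ×ˢ spanningSets β n with hR
  have hRm : ∀ n, MeasurableSet (R n) := fun n =>
    hS.inter ((measurableSet_spanningSets α n).prod (measurableSet_spanningSets β n))
  have hmono : Monotone R := fun i j hij => Set.inter_subset_inter_right _
    (Set.prod_mono (monotone_spanningSets α hij) (monotone_spanningSets β hij))
  have hU : S = ⋃ n, R n := by
    rw [hR, ← Set.inter_iUnion, Set.iUnion_prod_of_monotone (monotone_spanningSets α)
      (monotone_spanningSets β), iUnion_spanningSets, iUnion_spanningSets]
    simp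
  rw [hU] at hSf ⊢
  exact .of_tendsto hq1 hq' (u := fun n => (R n).indicator 1)
    (aestronglyMeasurable_one.indicator (.iUnion hRm))
    (fun n => aestronglyMeasurable_one.indicator (hRm n))
    (fun n => tensApprox_indicator_inter hq1 hq' (measurableSet_spanningSets α n)
      (measurableSet_spanningSets β n) (measure_spanningSets_lt_top α n).ne
      (measure_spanningSets_lt_top β n).ne hS)
    (tendsto_eLpNorm_indicator_sub_iUnion hRm hmono hSf (by simp) (by simp))
    (tendsto_eLpNorm_indicator_sub_iUnion hRm hmono hSf hq hq')

/-- One and the same sequence of simple functions converges to `f` in both norms, and the nonzero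
level sets of its terms have finite measure. -/
theorem tensApprox_of_memLp {α : Measure X} {β : Measure Y} [SigmaFinite α] [SigmaFinite β]
    (hq1 : 1 ≤ q) (hq' : q ≠ ∞) {f : X × Y → ℂ}
    (hf2 : MemLp f 2 (α.prod β)) (hfq : MemLp f q (α.prod β)) : TensApprox α β q f := by
  have hq : q ≠ 0 := (zero_lt_one.trans_le hq1).ne'
  wlog hfm : Measurable f generalizing f with H
  · have hae := hf2.1.ae_eq_mk
    have h := H ((memLp_congr_ae hae).1 hf2) ((memLp_congr_ae hae).1 hfq)
      hf2.1.stronglyMeasurable_mk.measurable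
    intro ε hε
    obtain ⟨u, hu, h2, h3⟩ := h ε hε
    refine ⟨u, hu, ?_, ?_⟩
    · rwa [eLpNorm_congr_ae ((ae_eq_refl u).sub hae)]
    · rwa [eLpNorm_congr_ae ((ae_eq_refl u).sub hae)]
  refine .of_tendsto hq1 hq' (u := fun n => SimpleFunc.approxOn f hfm (Set.range f ∪ {0}) 0
    (by simp) n) hf2.1 (fun n => SimpleFunc.aestronglyMeasurable _) (fun n => ?_)
    (SimpleFunc.tendsto_approxOn_range_Lp_eLpNorm (by simp) hfm hf2.2)
    (SimpleFunc.tendsto_approxOn_range_Lp_eLpNorm hq' hfm hfq.2)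
  have hs := SimpleFunc.memLp_approxOn_range hfm hf2 n
  generalize SimpleFunc.approxOn f hfm (Set.range f ∪ {0}) 0 (by simp) n = s at hs
  have e : (s : X × Y → ℂ) = ∑ y ∈ s.range, y • (s ⁻¹' {y}).indicator 1 := by
    ext z
    rw [Finset.sum_apply, Finset.sum_eq_single (s z)]
    · simp
    · intro y _ hy
      simp [Set.indicator, Ne.symm hy]
    · simp
  rw [e]
  refine .sum hq1 hq' _ (fun y _ => (aestronglyMeasurable_one.indicator
    (s.measurableSet_fiber y)).const_smul _) fun y _ => ?_
  by_cases hy : y = 0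
  · simpa [hy] using tensApprox_zero
  · exact (tensApprox_indicator hq1 hq' (s.measurableSet_fiber y)
      (SimpleFunc.measure_preimage_lt_top_of_memLp two_ne_zero (by simp) s hs y hy).ne).const_smul y

end Tensor

/-! ### Holomorphy of products and slices -/

section Slices

variable {X Y : Type*} [NormedAddCommGroup X] [NormedSpace ℂ X]
  [NormedAddCommGroup Y] [NormedSpace ℂ Y] {Ω₁ : Set X} {Ω₂ : Set Y}

theorem differentiableOn_tens {a : X → ℂ} {b : Y → ℂ} (ha : DifferentiableOn ℂ a Ω₁)
    (hb : DifferentiableOn ℂ b Ω₂) : DifferentiableOn ℂ (tens a b) (Ω₁ ×ˢ Ω₂) :=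
  (ha.comp differentiableOn_fst fun _ h => h.1).mul (hb.comp differentiableOn_snd fun _ h => h.2)

theorem differentiableOn_slice_left {G : X × Y → ℂ} (hG : DifferentiableOn ℂ G (Ω₁ ×ˢ Ω₂)) {y : Y}
    (hy : y ∈ Ω₂) : DifferentiableOn ℂ (fun x => G (x, y)) Ω₁ :=
  hG.comp (differentiableOn_id.prodMk (differentiableOn_const y)) fun _ hx => ⟨hx, hy⟩

theorem differentiableOn_slice_right {G : X × Y → ℂ} (hG : DifferentiableOn ℂ G (Ω₁ ×ˢ Ω₂)) {x : X}
    (hx : x ∈ Ω₁) : DifferentiableOn ℂ (fun y => G (x, y)) Ω₂ :=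
  hG.comp ((differentiableOn_const x).prodMk differentiableOn_id) fun _ hy => ⟨hx, hy⟩

end Slices

/-! ### Bergman projections of product domains -/

section ProductDomain

variable {X Y : Type*} [NormedAddCommGroup X] [NormedSpace ℂ X] [MeasurableSpace X]
  [NormedAddCommGroup Y] [NormedSpace ℂ Y] [MeasurableSpace Y]
  {Ω₁ : Set X} {Ω₂ : Set Y} {α : Measure X} {β : Measure Y}

variable [SFinite α] [SFinite β]

/-- Fubini: for almost every `y` the slice `G(·, y)` is a holomorphic `L²` function on the first
factor, hence orthogonal to `f - g`. -/
theorem IsBergmanProj.orth_tens_left {f g : X → ℂ} (h : IsBergmanProj Ω₁ α f g)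
    (hβ : ∀ᵐ y ∂β, y ∈ Ω₂) {u : Y → ℂ} (hu : MemLp u 2 β) {G : X × Y → ℂ}
    (hG : DifferentiableOn ℂ G (Ω₁ ×ˢ Ω₂)) (hG2 : MemLp G 2 (α.prod β)) :
    ∫ z, G z * conj (tens (f - g) u z) ∂α.prod β = 0 := by
  rw [integral_prod_symm _ (integrable_mul_conj hG2
    (memLp_tens (h.left.sub h.right) hu two_ne_zero (by simp)))]
  refine integral_eq_zero_of_ae ?_
  filter_upwards [hβ, ae_memLp_slice_left hG2] with y hy hGy
  have h1 := h.orth (differentiableOn_slice_left hG hy) hGy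
  have e : ∀ x, G (x, y) * conj (tens (f - g) u (x, y)) =
      (G (x, y) * conj (f x - g x)) * conj (u y) := by
    intro x; simp only [tens, Pi.sub_apply, map_mul]; ring
  simp_rw [e]
  rw [integral_mul_const, h1]
  simp

theorem IsBergmanProj.orth_tens_right {f g : Y → ℂ} (h : IsBergmanProj Ω₂ β f g)
    (hα : ∀ᵐ x ∂α, x ∈ Ω₁) {u : X → ℂ} (hu : MemLp u 2 α) {G : X × Y → ℂ}
    (hG : DifferentiableOn ℂ G (Ω₁ ×ˢ Ω₂)) (hG2 : MemLp G 2 (α.prod β)) :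
    ∫ z, G z * conj (tens u (f - g) z) ∂α.prod β = 0 := by
  rw [integral_prod _ (integrable_mul_conj hG2
    (memLp_tens hu (h.left.sub h.right) two_ne_zero (by simp)))]
  refine integral_eq_zero_of_ae ?_
  filter_upwards [hα, ae_memLp_slice_right hG2] with x hx hGx
  have h1 := h.orth (differentiableOn_slice_right hG hx) hGx
  have e : ∀ y, G (x, y) * conj (tens u (f - g) (x, y)) =
      (G (x, y) * conj (f y - g y)) * conj (u x) := by
    intro y; simp only [tens, Pi.sub_apply, map_mul]; ring
  simp_rw [e]
  rw [integral_mul_const, h1]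
  simp

/-- The Bergman projection of a product domain is the tensor product of the projections. -/
theorem IsBergmanProj.tens (hα : ∀ᵐ x ∂α, x ∈ Ω₁) (hβ : ∀ᵐ y ∂β, y ∈ Ω₂) {f₁ g₁ : X → ℂ}
    {f₂ g₂ : Y → ℂ} (h₁ : IsBergmanProj Ω₁ α f₁ g₁) (h₂ : IsBergmanProj Ω₂ β f₂ g₂) :
    IsBergmanProj (Ω₁ ×ˢ Ω₂) (α.prod β) (tens f₁ f₂) (tens g₁ g₂) := by
  obtain ⟨F₁, hF₁, hF₁2, hl₁⟩ := h₁.approx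
  obtain ⟨F₂, hF₂, hF₂2, hl₂⟩ := h₂.approx
  have h2 : (2 : ℝ≥0∞) ≠ 0 := two_ne_zero
  have h2' : (2 : ℝ≥0∞) ≠ ∞ := by simp
  refine .of_approx_orth (memLp_tens h₁.left h₂.left h2 h2') (memLp_tens h₁.right h₂.right h2 h2')
    (fun k => WeightedBergman.tens (F₁ k) (F₂ k)) (fun k => differentiableOn_tens (hF₁ k) (hF₂ k))
    (fun k => memLp_tens (hF₁2 k) (hF₂2 k) h2 h2') ?_ ?_
  · have hb : ∀ k, eLpNorm (WeightedBergman.tens (F₁ k) (F₂ k) - WeightedBergman.tens g₁ g₂) 2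
        (α.prod β) ≤ (eLpNorm (F₁ k - g₁) 2 α + eLpNorm g₁ 2 α) * eLpNorm (F₂ k - g₂) 2 β +
          eLpNorm (F₁ k - g₁) 2 α * eLpNorm g₂ 2 β := by
      intro k
      have e : WeightedBergman.tens (F₁ k) (F₂ k) - WeightedBergman.tens g₁ g₂ =
          WeightedBergman.tens (F₁ k) (F₂ k - g₂) + WeightedBergman.tens (F₁ k - g₁) g₂ := by
        ext z; simp only [WeightedBergman.tens, Pi.sub_apply, Pi.add_apply]; ring
      have hd₁ := (hF₁2 k).1.sub h₁.right.1
      have hd₂ := (hF₂2 k).1.sub h₂.right.1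
      rw [e]
      refine (eLpNorm_add_le (aestronglyMeasurable_tens (hF₁2 k).1 hd₂)
        (aestronglyMeasurable_tens hd₁ h₂.right.1) one_le_two).trans ?_
      rw [eLpNorm_tens (hF₁2 k).1 hd₂ h2 h2', eLpNorm_tens hd₁ h₂.right.1 h2 h2']
      gcongr
      calc eLpNorm (F₁ k) 2 α = eLpNorm (F₁ k - g₁ + g₁) 2 α := by rw [sub_add_cancel]
        _ ≤ _ := eLpNorm_add_le hd₁ h₁.right.1 one_le_two
    have hlim : Tendsto (fun k => (eLpNorm (F₁ k - g₁) 2 α + eLpNorm g₁ 2 α) *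
        eLpNorm (F₂ k - g₂) 2 β + eLpNorm (F₁ k - g₁) 2 α * eLpNorm g₂ 2 β) atTop
        (𝓝 ((0 + eLpNorm g₁ 2 α) * 0 + 0 * eLpNorm g₂ 2 β)) :=
      (ENNReal.Tendsto.mul (hl₁.add_const _) (Or.inr ENNReal.zero_ne_top) hl₂
        (Or.inr (by simpa using h₁.right.2.ne))).add
        (ENNReal.Tendsto.mul_const hl₁ (Or.inr h₂.right.2.ne))
    rw [mul_zero, zero_mul, add_zero] at hlim
    exact tendsto_of_tendsto_of_tendsto_of_le_of_le tendsto_const_nhds hlim (fun _ => zero_le) hb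
  · intro G hG hG2
    have i1 := h₁.orth_tens_left hβ h₂.left hG hG2
    have i2 := h₂.orth_tens_right hα h₁.right hG hG2
    -- Telescoping `f₁ ⊗ f₂ - g₁ ⊗ g₂ = (f₁ - g₁) ⊗ f₂ + g₁ ⊗ (f₂ - g₂)` leaves an orthogonal
    -- remainder in one variable in each term.
    have e : ∀ z, G z * conj (WeightedBergman.tens f₁ f₂ z - WeightedBergman.tens g₁ g₂ z) =
        G z * conj (WeightedBergman.tens (f₁ - g₁) f₂ z) +
          G z * conj (WeightedBergman.tens g₁ (f₂ - g₂) z) := by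
      intro z
      rw [← mul_add, ← map_add]
      congr 2
      simp only [WeightedBergman.tens, Pi.sub_apply]; ring
    simp_rw [e]
    rw [integral_add, i1, i2, add_zero]
    · exact integrable_mul_conj hG2 (memLp_tens (h₁.left.sub h₁.right) h₂.left h2 h2')
    · exact integrable_mul_conj hG2 (memLp_tens h₁.right (h₂.left.sub h₂.right) h2 h2')

theorem eLpNorm_ofReal_le_iff {Z : Type*} [MeasurableSpace Z] {ν : Measure Z} {f g : Z → ℂ} {p : ℝ}
    (hp : 0 < p) (C : ℝ≥0) :
    eLpNorm g (ENNReal.ofReal p) ν ≤ C * eLpNorm f (ENNReal.ofReal p) ν ↔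
      ∫⁻ x, ‖g x‖ₑ ^ p ∂ν ≤ (C : ℝ≥0∞) ^ p * ∫⁻ x, ‖f x‖ₑ ^ p ∂ν := by
  have h0 : ENNReal.ofReal p ≠ 0 := by simpa using hp
  simp only [eLpNorm_eq_lintegral_rpow_enorm_toReal h0 ENNReal.ofReal_ne_top,
    ENNReal.toReal_ofReal hp.le]
  rw [one_div, ENNReal.rpow_inv_le_iff hp, ENNReal.mul_rpow_of_nonneg _ _ hp.le,
    ENNReal.rpow_inv_rpow hp.ne']

/-- Bounded projections on two factors give a bounded projection on the product. -/
theorem IsLpBdd.prod {α : Measure X} {β : Measure Y} [SigmaFinite α] [SigmaFinite β]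
    (hα : ∀ᵐ x ∂α, x ∈ Ω₁) (hβ : ∀ᵐ y ∂β, y ∈ Ω₂) {p : ℝ} (hp : 1 < p)
    (h₁ : IsLpBdd Ω₁ α p) (h₂ : IsLpBdd Ω₂ β p) : IsLpBdd (Ω₁ ×ˢ Ω₂) (α.prod β) p := by
  obtain ⟨C₁, hC₁⟩ := h₁
  obtain ⟨C₂, hC₂⟩ := h₂
  have hp0 : 0 < p := zero_lt_one.trans hp
  have hp1 : 1 ≤ ENNReal.ofReal p := by simpa using hp.le
  have hq0 : ENNReal.ofReal p ≠ 0 := (zero_lt_one.trans_le hp1).ne'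
  refine .of_dense hp (Submodule.span ℂ {u : X × Y → ℂ | ∃ a b, u = tens a b ∧ MemLp a 2 α ∧
    MemLp a (ENNReal.ofReal p) α ∧ MemLp b 2 β ∧ MemLp b (ENNReal.ofReal p) β} :
      Submodule ℂ (X × Y → ℂ)) (C₁ * C₂) ?_ ?_
  · intro f hf2 hfp
    have h := tensApprox_of_memLp hp1 ENNReal.ofReal_ne_top hf2 hfp
    obtain ⟨ε, -, hε, hεl⟩ := exists_seq_strictAnti_tendsto' (zero_lt_one (α := ℝ≥0∞))
    choose u hu hu2 hup using fun k => h (ε k) (hε k).1.ne'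
    refine ⟨u, hu, fun k => (memLp_of_mem_span_tens hq0 ENNReal.ofReal_ne_top (hu k)).1,
      fun k => (memLp_of_mem_span_tens hq0 ENNReal.ofReal_ne_top (hu k)).2, ?_, ?_⟩
    · exact tendsto_of_tendsto_of_tendsto_of_le_of_le tendsto_const_nhds hεl (fun _ => zero_le) hu2
    · exact tendsto_of_tendsto_of_tendsto_of_le_of_le tendsto_const_nhds hεl (fun _ => zero_le) hup
  · intro f hf _ _
    obtain ⟨n, c, t, rfl⟩ := Submodule.mem_span_set'.1 hf
    choose a b ht ha hap hb hbp using fun i => (t i).2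
    choose a' ha' using fun i => exists_isBergmanProj Ω₁ ((ha i).const_smul (c i))
    choose b' hb' using fun i => exists_isBergmanProj Ω₂ (hb i)
    have e0 : (∑ i, c i • (t i : X × Y → ℂ)) = ∑ i, tens (c i • a i) (b i) := by
      refine Finset.sum_congr rfl fun i _ => ?_
      rw [ht i]
      ext z
      simp only [tens, Pi.smul_apply, smul_eq_mul]; ring
    rw [e0]
    refine ⟨∑ i, tens (a' i) (b' i), .sum _ fun i _ => .tens hα hβ (ha' i) (hb' i), ?_⟩
    have hm1 : AEStronglyMeasurable (∑ i, tens (c i • a i) (b' i)) (α.prod β) :=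
      Finset.aestronglyMeasurable_sum _ fun i _ =>
        aestronglyMeasurable_tens (ha' i).left.1 (hb' i).right.1
    have hm0 : AEStronglyMeasurable (∑ i, tens (c i • a i) (b i)) (α.prod β) :=
      Finset.aestronglyMeasurable_sum _ fun i _ =>
        aestronglyMeasurable_tens (ha' i).left.1 (hb' i).left.1
    have hm2 : AEStronglyMeasurable (∑ i, tens (a' i) (b' i)) (α.prod β) :=
      Finset.aestronglyMeasurable_sum _ fun i _ =>
        aestronglyMeasurable_tens (ha' i).right.1 (hb' i).right.1
    -- With `x` frozen, the sum is a linear combination of the `b i`, and its projection is the same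
    -- combination of the `b' i`. The bound on the second factor thus applies to every slice and is
    -- integrated in `x`.
    have s1 : ∫⁻ z, ‖(∑ i, tens (c i • a i) (b' i)) z‖ₑ ^ p ∂α.prod β ≤
        (C₂ : ℝ≥0∞) ^ p * ∫⁻ z, ‖(∑ i, tens (c i • a i) (b i)) z‖ₑ ^ p ∂α.prod β := by
      rw [lintegral_prod _ (hm1.enorm.pow_const _), lintegral_prod _ (hm0.enorm.pow_const _),
        ← lintegral_const_mul' _ _ (by simp [hp0.le])]
      refine lintegral_mono fun x => ?_
      have h := hC₂ (∑ i, (c i • a i) x • b i) (∑ i, (c i • a i) x • b' i)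
        (.sum _ fun i _ => (hb' i).const_smul _)
        (memLp_finsetSum' _ fun i _ => (hbp i).const_smul _)
      rw [eLpNorm_ofReal_le_iff hp0] at h
      simpa [tens] using h
    -- The same argument with `y` frozen, applied to the sum whose second factors have already been
    -- projected.
    have s2 : ∫⁻ z, ‖(∑ i, tens (a' i) (b' i)) z‖ₑ ^ p ∂α.prod β ≤
        (C₁ : ℝ≥0∞) ^ p * ∫⁻ z, ‖(∑ i, tens (c i • a i) (b' i)) z‖ₑ ^ p ∂α.prod β := by
      rw [lintegral_prod_symm _ (hm2.enorm.pow_const _),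
        lintegral_prod_symm _ (hm1.enorm.pow_const _),
        ← lintegral_const_mul' _ _ (by simp [hp0.le])]
      refine lintegral_mono fun y => ?_
      have h := hC₁ (∑ i, b' i y • (c i • a i)) (∑ i, b' i y • a' i)
        (.sum _ fun i _ => (ha' i).const_smul _)
        (memLp_finsetSum' _ fun i _ => ((hap i).const_smul _).const_smul _)
      rw [eLpNorm_ofReal_le_iff hp0] at h
      simpa [tens, mul_comm, mul_left_comm, mul_assoc] using h
    rw [eLpNorm_ofReal_le_iff hp0, ENNReal.coe_mul, ENNReal.mul_rpow_of_nonneg _ _ hp0.le,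
      mul_assoc]
    exact s2.trans (by gcongr)

/-- A bounded projection on a product, whose first factor has finite nonzero measure, gives a
bounded projection on the second factor. -/
theorem IsLpBdd.of_prod {α : Measure X} [IsFiniteMeasure α] (hα0 : α ≠ 0)
    (hα : ∀ᵐ x ∂α, x ∈ Ω₁) (hβ : ∀ᵐ y ∂β, y ∈ Ω₂) {p : ℝ} (hp : 1 < p)
    (h : IsLpBdd (Ω₁ ×ˢ Ω₂) (α.prod β) p) : IsLpBdd Ω₂ β p := by
  obtain ⟨C, hC⟩ := h
  have hp1 : 1 ≤ ENNReal.ofReal p := by simpa using hp.le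
  have hq0 : ENNReal.ofReal p ≠ 0 := (zero_lt_one.trans_le hp1).ne'
  refine ⟨C, fun f g hfg hf => ?_⟩
  have h1 : IsBergmanProj Ω₁ α (fun _ => 1) (fun _ => 1) :=
    .of_approx_orth (memLp_const _) (memLp_const _) (fun _ _ => 1)
      (fun _ => differentiableOn_const _) (fun _ => memLp_const _) (by simp) (by simp)
  have h2 := hC _ _ (.tens hα hβ h1 hfg)
    (memLp_tens (memLp_const _) hf hq0 ENNReal.ofReal_ne_top)
  rw [eLpNorm_tens h1.left.1 hfg.left.1 hq0 ENNReal.ofReal_ne_top,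
    eLpNorm_tens h1.left.1 hfg.right.1 hq0 ENNReal.ofReal_ne_top, mul_left_comm] at h2
  -- Cancelling `‖1‖_p` requires it to be neither zero nor infinite, that is, the first measure to
  -- be nonzero and finite.
  refine (ENNReal.mul_le_mul_iff_right ?_ ?_).1 h2
  · rw [eLpNorm_const _ hq0 hα0]
    simp only [enorm_one, one_mul]
    exact (ENNReal.rpow_pos (pos_iff_ne_zero.2 (Measure.measure_univ_ne_zero.2 hα0)) (measure_ne_top α _)).ne'
  · exact (memLp_const (1 : ℂ)).2.ne

end ProductDomain

/-- The Euclidean unit ball of `ℂ^m`. -/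
def unitBall (m : ℕ) : Set (Fin m → ℂ) := {z | ∑ i, ‖z i‖ ^ 2 < 1}

theorem isOpen_unitBall (m : ℕ) : IsOpen (unitBall m) :=
  isOpen_lt (by fun_prop) continuous_const

theorem zero_mem_unitBall (m : ℕ) : (0 : Fin m → ℂ) ∈ unitBall m := by simp [unitBall]

theorem volume_unitBall_ne_top (m : ℕ) : volume (unitBall m) ≠ ∞ := by
  -- The norm of `Fin m → ℂ` is the sup norm, so this `Metric.ball` is a polydisc containing the
  -- Euclidean ball.
  refine ne_top_of_le_ne_top (measure_ball_lt_top (x := (0 : Fin m → ℂ)) (r := 1)).ne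
    (measure_mono fun z hz => ?_)
  rw [mem_ball_zero_iff, pi_norm_lt_iff one_pos]
  intro i
  have h : ‖z i‖ ^ 2 ≤ ∑ j, ‖z j‖ ^ 2 :=
    Finset.single_le_sum (f := fun j => ‖z j‖ ^ 2) (fun j _ => by positivity) (Finset.mem_univ i)
  have h1 : ‖z i‖ ^ 2 < 1 := h.trans_lt hz
  exact (sq_lt_one_iff₀ (norm_nonneg _)).1 h1

instance (m : ℕ) : IsFiniteMeasure (volume.restrict (unitBall m)) :=
  isFiniteMeasure_restrict.2 (volume_unitBall_ne_top m)

theorem volume_unitBall_ne_zero (m : ℕ) : volume (unitBall m) ≠ 0 :=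
  ((isOpen_unitBall m).measure_pos _ ⟨0, zero_mem_unitBall m⟩).ne'

/-- The real determinant of a complex linear map is the squared modulus of its complex determinant.
-/
theorem lintegral_comp_complexLinear {V : Type*} [NormedAddCommGroup V] [NormedSpace ℂ V]
    [NormedSpace ℝ V] [IsScalarTower ℝ ℂ V] [FiniteDimensional ℝ V] [MeasurableSpace V]
    [BorelSpace V] (ν : Measure V) [ν.IsAddHaarMeasure] (L : V →ₗ[ℂ] V)
    (hL : LinearMap.det L ≠ 0) {h : V → ℝ≥0∞} (hm : Measurable h) :
    ∫⁻ z, h z ∂ν = ENNReal.ofReal (‖LinearMap.det L‖ ^ 2) * ∫⁻ z, h (L z) ∂ν := by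
  have hdet : LinearMap.det (L.restrictScalars ℝ) = ‖LinearMap.det L‖ ^ 2 := by
    rw [LinearMap.det_restrictScalars, Algebra.norm_complex_apply, Complex.normSq_eq_norm_sq]
  have hne : LinearMap.det (L.restrictScalars ℝ) ≠ 0 := by
    rw [hdet]; positivity
  have hmap := Measure.map_linearMap_addHaar_eq_smul_addHaar ν hne
  have hLm : Measurable (L.restrictScalars ℝ) :=
    (L.restrictScalars ℝ).continuous_of_finiteDimensional.measurable
  have e : ∫⁻ z, h (L z) ∂ν = ∫⁻ z, h z ∂(Measure.map (L.restrictScalars ℝ) ν) :=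
    (lintegral_map hm hLm).symm
  rw [e, hmap, lintegral_smul_measure, hdet, smul_eq_mul, ← mul_assoc,
    ← ENNReal.ofReal_mul (by positivity), abs_of_nonneg (by positivity), mul_inv_cancel₀
    (by positivity), ENNReal.ofReal_one, one_mul]

theorem lintegral_comp_smul_pi {m : ℕ} {c : ℂ} (hc : c ≠ 0) {h : (Fin m → ℂ) → ℝ≥0∞}
    (hm : Measurable h) :
    ∫⁻ z, h z = ENNReal.ofReal ((‖c‖ ^ 2) ^ m) * ∫⁻ z, h (c • z) := by
  have hd : LinearMap.det (c • (LinearMap.id : (Fin m → ℂ) →ₗ[ℂ] Fin m → ℂ)) = c ^ m := by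
    rw [LinearMap.det_smul]; simp
  have h1 := lintegral_comp_complexLinear volume
    (c • (LinearMap.id : (Fin m → ℂ) →ₗ[ℂ] Fin m → ℂ)) (by rw [hd]; exact pow_ne_zero _ hc) hm
  rw [hd, norm_pow, ← pow_mul, mul_comm m, pow_mul] at h1
  exact h1

/-! ### Weighted measures and inflations over a general base -/

section WeightedMeasure

variable {E : Type*} [MeasureSpace E] {Ω : Set E}

theorem weightedMeasure_congr (hΩ : MeasurableSet Ω) {μ μ' : E → ℝ} (h : Set.EqOn μ μ' Ω) :
    weightedMeasure Ω μ = weightedMeasure Ω μ' := by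
  refine withDensity_congr_ae ?_
  filter_upwards [ae_restrict_mem hΩ] with x hx
  rw [h hx]

theorem ae_weightedMeasure_mem (hΩ : MeasurableSet Ω) (μ : E → ℝ) :
    ∀ᵐ x ∂weightedMeasure Ω μ, x ∈ Ω :=
  (withDensity_absolutelyContinuous _ _).ae_le (ae_restrict_mem hΩ)

theorem lintegral_weightedMeasure (hΩ : MeasurableSet Ω) {μ : E → ℝ} (hμ : Measurable μ)
    {f : E → ℝ≥0∞} (hf : Measurable f) :
    ∫⁻ x, f x ∂weightedMeasure Ω μ = ∫⁻ x, Ω.indicator (fun x => ENNReal.ofReal (μ x) * f x) x := by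
  rw [weightedMeasure, lintegral_withDensity_eq_lintegral_mul _ hμ.ennreal_ofReal hf,
    lintegral_indicator hΩ]
  rfl

instance [SigmaFinite (volume : Measure E)] (μ : E → ℝ) : SigmaFinite (weightedMeasure Ω μ) :=
  SigmaFinite.withDensity_ofReal _

end WeightedMeasure

theorem sum_norm_sq_smul {m : ℕ} (c : ℂ) (z : Fin m → ℂ) :
    ∑ i, ‖(c • z) i‖ ^ 2 = ‖c‖ ^ 2 * ∑ i, ‖z i‖ ^ 2 := by
  simp [Finset.mul_sum, mul_pow]

/-- The set `{(z, w) : |z|² < μ(w), w ∈ Ω}` over a general base. -/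
def inflationOver {Y : Type*} (m : ℕ) (Ω : Set Y) (μ : Y → ℝ) : Set ((Fin m → ℂ) × Y) :=
  {x | ∑ i, ‖x.1 i‖ ^ 2 < μ x.2 ∧ x.2 ∈ Ω}

theorem smul_mem_inflationOver_iff {Y : Type*} {m : ℕ} {Ω : Set Y} {g : Y → ℂ} (hg0 : ∀ w, g w ≠ 0)
    (ζ : Fin m → ℂ) (w : Y) :
    (g w • ζ, w) ∈ inflationOver m Ω (fun w => ‖g w‖ ^ 2) ↔ ζ ∈ unitBall m ∧ w ∈ Ω := by
  have h : 0 < ‖g w‖ ^ 2 := by have := hg0 w; positivity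
  simp only [inflationOver, unitBall, Set.mem_ofPred_eq, sum_norm_sq_smul]
  rw [mul_lt_iff_lt_one_right h]

/-! ### The change of variables `(ζ, w) ↦ (g(w) ζ, w)` -/

section ChangeOfVariables

variable {Y : Type*} [MeasureSpace Y] {m : ℕ}

/-- The map `(ζ, w) ↦ (g(w) ζ, w)`. -/
def fiberScaling (m : ℕ) {g : Y → ℂ} (hg : Measurable g) (hg0 : ∀ w, g w ≠ 0) :
    ((Fin m → ℂ) × Y) ≃ᵐ ((Fin m → ℂ) × Y) where
  toFun x := (g x.2 • x.1, x.2)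
  invFun x := ((g x.2)⁻¹ • x.1, x.2)
  left_inv x := by simp [smul_smul, hg0]
  right_inv x := by simp [smul_smul, hg0]
  measurable_toFun := ((hg.comp measurable_snd).smul measurable_fst).prodMk measurable_snd
  measurable_invFun := ((hg.comp measurable_snd).inv.smul measurable_fst).prodMk measurable_snd

theorem measurableSet_inflationOver {Ω : Set Y} (hΩ : MeasurableSet Ω)
    {μ : Y → ℝ} (hμ : Measurable μ) : MeasurableSet (inflationOver m Ω μ) :=
  (measurableSet_lt (by fun_prop) (hμ.comp measurable_snd)).inter (measurable_snd hΩ)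

/-- By Tonelli it suffices to substitute `z = g(w) ζ` at fixed `w`, where the Jacobian is
`|g(w)|^(2m)`. Only measurability of `g` is needed, so the same statement also serves to slice the
unit ball. -/
theorem measurePreserving_fiberScaling [SigmaFinite (volume : Measure Y)] {Ω : Set Y} (hΩ : MeasurableSet Ω)
    {g : Y → ℂ} (hg : Measurable g) (hg0 : ∀ w, g w ≠ 0) {lam : Y → ℝ}
    (hlam : Measurable lam) :
    MeasurePreserving (fiberScaling m hg hg0)
      ((volume.restrict (unitBall m)).prod
        (weightedMeasure Ω fun w => (‖g w‖ ^ 2) ^ m * lam w))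
      (weightedMeasure (inflationOver m Ω fun w => ‖g w‖ ^ 2) fun x => lam x.2) := by
  refine ⟨(fiberScaling m hg hg0).measurable, Measure.ext_of_lintegral _ fun f hf => ?_⟩
  have hgn : Measurable fun w => ‖g w‖ ^ 2 := by fun_prop
  have hI := measurableSet_inflationOver (m := m) hΩ hgn
  have hfΦ : Measurable fun x => f (fiberScaling m hg hg0 x) :=
    hf.comp (fiberScaling m hg hg0).measurable
  have hF : Measurable ((inflationOver m Ω fun w => ‖g w‖ ^ 2).indicator
      fun x => ENNReal.ofReal (lam x.2) * f x) :=
    ((hlam.comp measurable_snd).ennreal_ofReal.mul hf).indicator hI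
  rw [lintegral_map hf (fiberScaling m hg hg0).measurable, lintegral_prod_symm' _ hfΦ,
    lintegral_weightedMeasure (μ := fun x => lam x.2) hI (hlam.comp measurable_snd) hf,
    lintegral_weightedMeasure (μ := fun w => (‖g w‖ ^ 2) ^ m * lam w) hΩ
      ((hgn.pow_const m).mul hlam) hfΦ.lintegral_prod_left',
    Measure.volume_eq_prod, lintegral_prod_symm' _ hF]
  refine lintegral_congr fun w => ?_
  have hmeas : Measurable fun z : Fin m → ℂ => (inflationOver m Ω fun w => ‖g w‖ ^ 2).indicator
      (fun x => ENNReal.ofReal (lam x.2) * f x) (z, w) :=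
    hF.comp measurable_prodMk_right
  rw [lintegral_comp_smul_pi (hg0 w) hmeas]
  by_cases hw : w ∈ Ω
  · have e : ∀ z : Fin m → ℂ, (inflationOver m Ω fun w => ‖g w‖ ^ 2).indicator
        (fun x => ENNReal.ofReal (lam x.2) * f x) (g w • z, w) =
        ENNReal.ofReal (lam w) * (unitBall m).indicator (fun z => f (g w • z, w)) z := by
      intro z
      by_cases hz : z ∈ unitBall m
      · rw [Set.indicator_of_mem ((smul_mem_inflationOver_iff hg0 z w).2 ⟨hz, hw⟩),
          Set.indicator_of_mem hz]
      · rw [Set.indicator_of_notMem (fun h => hz ((smul_mem_inflationOver_iff hg0 z w).1 h).1),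
          Set.indicator_of_notMem hz, mul_zero]
    simp_rw [e]
    rw [lintegral_const_mul' _ _ ENNReal.ofReal_ne_top, Set.indicator_of_mem hw,
      lintegral_indicator (isOpen_unitBall m).measurableSet, ENNReal.ofReal_mul (by positivity),
      mul_assoc]
    rfl
  · have e : ∀ z : Fin m → ℂ, (inflationOver m Ω fun w => ‖g w‖ ^ 2).indicator
        (fun x => ENNReal.ofReal (lam x.2) * f x) (g w • z, w) = 0 := fun z =>
      Set.indicator_of_notMem (fun h => hw ((smul_mem_inflationOver_iff hg0 z w).1 h).2) _
    simp_rw [e]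
    simp [hw]

theorem isLpBounded_inflation_iff {n : ℕ} {Ω : Set (Fin n → ℂ)} (hΩ : IsOpen Ω) {g : (Fin n → ℂ) → ℂ}
    (hg : DifferentiableOn ℂ g Ω) (hg_ne : ∀ w ∈ Ω, g w ≠ 0) {μ : (Fin n → ℂ) → ℝ}
    (hμ : ∀ w ∈ Ω, μ w = ‖g w‖ ^ 2) {lam : (Fin n → ℂ) → ℝ} (hlam : ContinuousOn lam Ω) (p : ℝ) :
    IsLpBounded (inflation m Ω μ) (fun x => lam x.2) p ↔
      IsLpBdd (unitBall m ×ˢ Ω) ((volume.restrict (unitBall m)).prod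
        (weightedMeasure Ω fun w => μ w ^ m * lam w)) p := by
  classical
  -- Nothing is known about `g` and `lam` off `Ω`. Replacing them by `1` there makes the scaling a
  -- measurable bijection of the whole space without changing either measure.
  set g' : (Fin n → ℂ) → ℂ := Ω.piecewise g 1 with hg'
  set lam' : (Fin n → ℂ) → ℝ := Ω.piecewise lam 1 with hlam'
  have eg : Set.EqOn g' g Ω := Set.piecewise_eqOn _ _ _
  have el : Set.EqOn lam' lam Ω := Set.piecewise_eqOn _ _ _
  have hgm : Measurable g' :=
    hg.continuousOn.measurable_piecewise continuousOn_const hΩ.measurableSet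
  have hlm : Measurable lam' := hlam.measurable_piecewise continuousOn_const hΩ.measurableSet
  have hg0 : ∀ w, g' w ≠ 0 := by
    intro w
    by_cases hw : w ∈ Ω
    · rw [eg hw]; exact hg_ne w hw
    · simp [hg', hw]
  have hgd : DifferentiableOn ℂ g' Ω := hg.congr eg
  have e1 : inflation m Ω μ = inflationOver m Ω fun w => ‖g' w‖ ^ 2 := by
    ext x
    refine and_congr_left fun hx => ?_
    simp only [hμ _ hx, eg hx]
  have e2 : weightedMeasure (inflationOver m Ω fun w => ‖g' w‖ ^ 2) (fun x => lam x.2) =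
      weightedMeasure (inflationOver m Ω fun w => ‖g' w‖ ^ 2) fun x => lam' x.2 :=
    weightedMeasure_congr (measurableSet_inflationOver hΩ.measurableSet (by fun_prop))
      fun x hx => (el hx.2).symm
  have e3 : (weightedMeasure Ω fun w => μ w ^ m * lam w) =
      weightedMeasure Ω fun w => (‖g' w‖ ^ 2) ^ m * lam' w :=
    weightedMeasure_congr hΩ.measurableSet fun w hw => by
      simp only [hμ w hw, eg hw, el hw]
  rw [isLpBounded_iff_isLpBdd, e1, e2, e3]
  refine (isLpBdd_iff_of_measurableEquiv (fiberScaling m hgm hg0)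
    (measurePreserving_fiberScaling hΩ.measurableSet hgm hg0 hlm) ?_ ?_ ?_ ?_).symm
  · exact ((hgd.comp differentiableOn_snd fun x hx => hx.2).smul differentiableOn_fst).prodMk
      differentiableOn_snd
  · exact (((hgd.comp differentiableOn_snd fun x hx => hx.2).inv fun x _ => hg0 _).smul
      differentiableOn_fst).prodMk differentiableOn_snd
  · exact fun x hx => (smul_mem_inflationOver_iff hg0 _ _).2 hx
  · intro x hx
    have hx' : (g' x.2 • (g' x.2)⁻¹ • x.1, x.2) ∈ inflationOver m Ω fun w => ‖g' w‖ ^ 2 := by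
      rwa [smul_inv_smul₀ (hg0 _)]
    exact (smul_mem_inflationOver_iff hg0 _ _).1 hx'

end ChangeOfVariables

/-! ### Mean values under rotation invariant measures -/

section Rotation

variable {V : Type*} [NormedAddCommGroup V] [NormedSpace ℂ V] [MeasurableSpace V] [BorelSpace V]

/-- Mean value property with respect to a rotation invariant finite measure. -/
theorem integral_eq_of_rotation_invariant [SecondCountableTopology V] {ν : Measure V}
    [IsFiniteMeasure ν] (hrot : ∀ c : ℂ, ‖c‖ = 1 → MeasurePreserving (fun v => c • v) ν ν) {S : Set V}
    (hbal : ∀ v ∈ S, ∀ c : ℂ, ‖c‖ ≤ 1 → c • v ∈ S) (hνS : ∀ᵐ v ∂ν, v ∈ S) {G : V → ℂ}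
    (hG : DifferentiableOn ℂ G S) (hGi : Integrable G ν) :
    ∫ v, G v ∂ν = ν.real Set.univ * G 0 := by
  set I : Measure ℝ := volume.restrict (Set.Ioc 0 (2 * Real.pi)) with hI
  have hpi : 0 ≤ 2 * Real.pi := by positivity
  have hIr : I.real Set.univ = 2 * Real.pi := by simp [hI, hpi]
  have hnorm : ∀ θ : ℝ, ‖circleMap 0 1 θ‖ = 1 := fun θ => by simp
  have hmeas : Measurable (Function.uncurry fun (θ : ℝ) (v : V) => circleMap 0 1 θ • v) :=
    (((continuous_circleMap 0 1).comp continuous_fst).smul continuous_snd).measurable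
  -- The shear `(θ, v) ↦ (θ, e^{iθ} v)` preserves the product measure, which supplies the
  -- integrability needed to exchange the two integrals.
  have hΨ := (MeasurePreserving.id I).skew_product (g := fun (θ : ℝ) (v : V) => circleMap 0 1 θ • v)
    (μc := ν) (μd := ν) hmeas (Eventually.of_forall fun θ => (hrot _ (hnorm θ)).map_eq)
  have hint : Integrable (Function.uncurry fun (θ : ℝ) (v : V) => G (circleMap 0 1 θ • v))
      (I.prod ν) := (hΨ.integrable_comp (hGi.comp_snd I).1).2 (hGi.comp_snd I)
  have hswap := integral_integral_swap hint
  have h1 : ∀ θ : ℝ, ∫ v, G (circleMap 0 1 θ • v) ∂ν = ∫ v, G v ∂ν := by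
    intro θ
    have hp := hrot _ (hnorm θ)
    conv_rhs => rw [← hp.map_eq]
    rw [integral_map hp.measurable.aemeasurable]
    rw [hp.map_eq]
    exact hGi.1
  -- Since `S` is balanced, the closed disc `{t • v : ‖t‖ ≤ 1}` lies in `S`, and the one-variable
  -- mean value property applies along it.
  have h2 : ∀ v ∈ S, ∫ θ, G (circleMap 0 1 θ • v) ∂I = (2 * Real.pi : ℝ) • G 0 := by
    intro v hv
    have hd : DiffContOnCl ℂ (fun t : ℂ => G (t • v)) (Metric.ball 0 |1|) := by
      refine DifferentiableOn.diffContOnCl ?_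
      refine hG.comp (by fun_prop) fun t ht => hbal v hv t ?_
      have := Metric.closure_ball_subset_closedBall ht
      simpa using this
    have hc := hd.circleAverage
    rw [Real.circleAverage, intervalIntegral.integral_of_le hpi, zero_smul] at hc
    rw [← hc, smul_inv_smul₀ (by positivity)]
  simp_rw [h1] at hswap
  rw [integral_congr_ae (hνS.mono h2), integral_const, integral_const, hIr] at hswap
  rw [smul_comm] at hswap
  have h3 : (2 * Real.pi : ℝ) ≠ 0 := by positivity
  simpa using smul_right_injective ℂ h3 hswap

theorem measurePreserving_of_norm_det_eq_one [NormedSpace ℝ V] [IsScalarTower ℝ ℂ V]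
    [FiniteDimensional ℝ V] (ν : Measure V) [ν.IsAddHaarMeasure] (L : V →ₗ[ℂ] V)
    (hL : ‖LinearMap.det L‖ = 1) : MeasurePreserving L ν ν := by
  have hm : Measurable L := (L.restrictScalars ℝ).continuous_of_finiteDimensional.measurable
  refine ⟨hm, Measure.ext_of_lintegral _ fun f hf => ?_⟩
  rw [lintegral_map hf hm, lintegral_comp_complexLinear ν L (by
    rw [← norm_ne_zero_iff, hL]; exact one_ne_zero) hf, hL]
  simp

theorem measurePreserving_const_smul [NormedSpace ℝ V] [IsScalarTower ℝ ℂ V]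
    [FiniteDimensional ℝ V] (ν : Measure V) [ν.IsAddHaarMeasure] {c : ℂ} (hc : ‖c‖ = 1) :
    MeasurePreserving (fun v => c • v) ν ν := by
  refine measurePreserving_of_norm_det_eq_one ν (c • (LinearMap.id : V →ₗ[ℂ] V)) ?_
  rw [LinearMap.det_smul]
  simp [hc]

theorem MeasurePreserving.withDensity_of_comp_eq {Z : Type*} [MeasurableSpace Z] {ν : Measure Z}
    {T : Z → Z} (hT : MeasurePreserving T ν ν) {w : Z → ℝ≥0∞} (hw : Measurable w)
    (hwT : ∀ z, w (T z) = w z) : MeasurePreserving T (ν.withDensity w) (ν.withDensity w) := by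
  refine ⟨hT.measurable, Measure.ext_of_lintegral _ fun f hf => ?_⟩
  rw [lintegral_map hf hT.measurable, lintegral_withDensity_eq_lintegral_mul _ hw hf,
    show ∫⁻ z, f (T z) ∂ν.withDensity w = ∫⁻ z, (w * fun z => f (T z)) z ∂ν from
      lintegral_withDensity_eq_lintegral_mul _ hw (hf.comp hT.measurable),
    ← hT.lintegral_comp (hw.mul hf)]
  simp [hwT]

end Rotation

/-! ### Slicing the unit ball over the disc -/

section Slicing

/-- The measure `(1 - |a|²)^k dV` on the unit disc. -/
def discMeasure (k : ℕ) : Measure ℂ :=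
  weightedMeasure (Metric.ball 0 1) fun a => (1 - ‖a‖ ^ 2) ^ k

instance (k : ℕ) : IsFiniteMeasure (discMeasure k) := by
  refine isFiniteMeasure_withDensity ?_
  refine ne_top_of_le_ne_top (measure_ball_lt_top (x := (0 : ℂ)) (r := 1) (μ := volume)).ne ?_
  rw [← setLIntegral_one]
  refine setLIntegral_mono measurable_const fun a ha => ?_
  rw [mem_ball_zero_iff] at ha
  have h : ‖a‖ ^ 2 ≤ 1 := pow_le_one₀ (norm_nonneg _) ha.le
  rw [ENNReal.ofReal_le_one]
  exact pow_le_one₀ (by linarith) (by linarith [sq_nonneg ‖a‖])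

theorem ae_discMeasure_mem (k : ℕ) : ∀ᵐ a ∂discMeasure k, a ∈ Metric.ball (0 : ℂ) 1 :=
  ae_weightedMeasure_mem Metric.isOpen_ball.measurableSet _

theorem lintegral_discMeasure (k : ℕ) {f : ℂ → ℝ≥0∞} (hf : Measurable f) :
    ∫⁻ a, f a ∂discMeasure k =
      ∫⁻ a in Metric.ball 0 1, ENNReal.ofReal ((1 - ‖a‖ ^ 2) ^ k) * f a := by
  rw [discMeasure, lintegral_weightedMeasure Metric.isOpen_ball.measurableSet (by fun_prop) hf,
    lintegral_indicator Metric.isOpen_ball.measurableSet]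

theorem measurePreserving_smul_discMeasure (k : ℕ) {c : ℂ} (hc : ‖c‖ = 1) :
    MeasurePreserving (fun a => c • a) (discMeasure k) (discMeasure k) := by
  refine MeasurePreserving.withDensity_of_comp_eq ?_ (by fun_prop) fun z => by simp [hc]
  have h := (measurePreserving_const_smul (volume : Measure ℂ) hc).restrict_preimage
    (Metric.isOpen_ball (x := (0 : ℂ)) (ε := 1)).measurableSet
  have e : (fun a : ℂ => c • a) ⁻¹' Metric.ball 0 1 = Metric.ball 0 1 := by
    ext z
    simp [hc]
  rwa [e] at h

theorem integral_discMeasure_eq (k : ℕ) {G : ℂ → ℂ}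
    (hG : DifferentiableOn ℂ G (Metric.ball 0 1)) (hGi : Integrable G (discMeasure k)) :
    ∫ a, G a ∂discMeasure k = (discMeasure k).real Set.univ * G 0 := by
  refine integral_eq_of_rotation_invariant (fun c hc => measurePreserving_smul_discMeasure k hc)
    (fun v hv c hc => ?_) (ae_discMeasure_mem k) hG hGi
  rw [mem_ball_zero_iff] at hv ⊢
  rw [norm_smul]
  exact (mul_le_of_le_one_left (norm_nonneg _) hc).trans_lt hv

theorem smul_mem_unitBall {k : ℕ} {v : Fin k → ℂ} (hv : v ∈ unitBall k) {c : ℂ} (hc : ‖c‖ ≤ 1) :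
    c • v ∈ unitBall k := by
  rw [unitBall, Set.mem_ofPred_eq, sum_norm_sq_smul]
  refine lt_of_le_of_lt (mul_le_of_le_one_left ?_ (pow_le_one₀ (norm_nonneg _) hc)) hv
  positivity

theorem integral_unitBall_eq (k : ℕ) {G : (Fin k → ℂ) → ℂ} (hG : DifferentiableOn ℂ G (unitBall k))
    (hGi : IntegrableOn G (unitBall k)) :
    ∫ v in unitBall k, G v = volume.real (unitBall k) * G 0 := by
  rw [integral_eq_of_rotation_invariant (S := unitBall k) (fun c hc => ?_)
    (fun v hv c hc => smul_mem_unitBall hv hc)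
    (ae_restrict_mem (isOpen_unitBall k).measurableSet) hG hGi]
  · simp
  · have h := (measurePreserving_const_smul (volume : Measure (Fin k → ℂ)) hc).restrict_preimage
      (isOpen_unitBall k).measurableSet
    have e : (fun v : Fin k → ℂ => c • v) ⁻¹' unitBall k = unitBall k := by
      ext z
      simp only [Set.mem_preimage, unitBall, Set.mem_ofPred_eq, sum_norm_sq_smul, hc]
      simp
    rwa [e] at h

/-- The radius of the slice of the unit ball over `a`, extended by `1` outside the disc. -/
def sliceRadius (a : ℂ) : ℂ := if ‖a‖ < 1 then ((√(1 - ‖a‖ ^ 2) : ℝ) : ℂ) else 1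

theorem measurable_sliceRadius : Measurable sliceRadius :=
  Measurable.ite (measurableSet_lt measurable_norm measurable_const) (by fun_prop) measurable_const

theorem sliceRadius_ne_zero (a : ℂ) : sliceRadius a ≠ 0 := by
  unfold sliceRadius
  split_ifs with h
  · have : ‖a‖ ^ 2 < 1 := (sq_lt_one_iff₀ (norm_nonneg _)).2 h
    have h2 : 0 < √(1 - ‖a‖ ^ 2) := Real.sqrt_pos.2 (by linarith)
    exact_mod_cast h2.ne'
  · exact one_ne_zero

theorem norm_sliceRadius_sq {a : ℂ} (h : ‖a‖ < 1) : ‖sliceRadius a‖ ^ 2 = 1 - ‖a‖ ^ 2 := by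
  have : ‖a‖ ^ 2 < 1 := (sq_lt_one_iff₀ (norm_nonneg _)).2 h
  rw [sliceRadius, if_pos h, Complex.norm_real, Real.norm_eq_abs, sq_abs,
    Real.sq_sqrt (by linarith)]

/-- Parametrization of the ball of `ℂ^(k+1)` by the ball of `ℂ^k` and the disc. -/
def sliceMap (k : ℕ) (x : (Fin k → ℂ) × ℂ) : Fin (k + 1) → ℂ :=
  Fin.cons x.2 (sliceRadius x.2 • x.1)

theorem measurePreserving_cons (k : ℕ) :
    MeasurePreserving (fun x : (Fin k → ℂ) × ℂ => (Fin.cons x.2 x.1 : Fin (k + 1) → ℂ)) := by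
  have h := ((volume_preserving_piFinSuccAbove (fun _ : Fin (k + 1) => ℂ) 0).symm _).comp
    (Measure.measurePreserving_swap (μ := (volume : Measure (Fin k → ℂ)))
      (ν := (volume : Measure ℂ)))
  refine (?_ : (fun x : (Fin k → ℂ) × ℂ => (Fin.cons x.2 x.1 : Fin (k + 1) → ℂ)) = _) ▸ h
  ext x i
  simp [MeasurableEquiv.piFinSuccAbove, Fin.insertNthEquiv]

theorem sum_norm_sq_cons {k : ℕ} (a : ℂ) (b : Fin k → ℂ) :
    ∑ i, ‖(Fin.cons a b : Fin (k + 1) → ℂ) i‖ ^ 2 = ‖a‖ ^ 2 + ∑ i, ‖b i‖ ^ 2 := by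
  simp [Fin.sum_univ_succ]

/-- The ball of `ℂ^(k+1)` is, up to the order of coordinates, the inflation of the disc with fibre
radius `√(1 - |a|²)`, whose Jacobian `(1 - |a|²)^k` is the weight of `discMeasure k`. The radius is
not holomorphic in `a`, but only its measurability matters here. -/
theorem measurePreserving_sliceMap (k : ℕ) :
    MeasurePreserving (sliceMap k) ((volume.restrict (unitBall k)).prod (discMeasure k))
      (volume.restrict (unitBall (k + 1))) := by
  have h1 := measurePreserving_fiberScaling (m := k)
    (Metric.isOpen_ball (x := (0 : ℂ)) (ε := 1)).measurableSet measurable_sliceRadius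
    sliceRadius_ne_zero (lam := fun _ => 1) measurable_const
  have e1 : (weightedMeasure (Metric.ball (0 : ℂ) 1) fun w => (‖sliceRadius w‖ ^ 2) ^ k * 1) =
      discMeasure k :=
    weightedMeasure_congr Metric.isOpen_ball.measurableSet fun a ha => by
      rw [mem_ball_zero_iff] at ha
      simp only [norm_sliceRadius_sq ha, mul_one]
  have e2 : weightedMeasure (inflationOver k (Metric.ball (0 : ℂ) 1) fun w => ‖sliceRadius w‖ ^ 2)
      (fun _ => 1) = volume.restrict
        (inflationOver k (Metric.ball (0 : ℂ) 1) fun w => ‖sliceRadius w‖ ^ 2) := by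
    simp [weightedMeasure]
  have e3 : (inflationOver k (Metric.ball (0 : ℂ) 1) fun w => ‖sliceRadius w‖ ^ 2) =
      (fun x : (Fin k → ℂ) × ℂ => (Fin.cons x.2 x.1 : Fin (k + 1) → ℂ)) ⁻¹' unitBall (k + 1) := by
    ext ⟨b, a⟩
    simp only [inflationOver, unitBall, Set.mem_ofPred_eq, Set.mem_preimage, sum_norm_sq_cons,
      mem_ball_zero_iff]
    constructor
    · rintro ⟨hb, ha⟩
      rw [norm_sliceRadius_sq ha] at hb
      linarith
    · intro h
      have hb : 0 ≤ ∑ i, ‖b i‖ ^ 2 := by positivity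
      have ha : ‖a‖ < 1 := (sq_lt_one_iff₀ (norm_nonneg _)).1 (by linarith)
      rw [norm_sliceRadius_sq ha]
      exact ⟨by linarith, ha⟩
  rw [e1, e2, e3] at h1
  exact ((measurePreserving_cons k).restrict_preimage
    (isOpen_unitBall (k + 1)).measurableSet).comp h1

theorem sliceMap_mem {k : ℕ} {b : Fin k → ℂ} (hb : b ∈ unitBall k) {a : ℂ} (ha : ‖a‖ < 1) :
    sliceMap k (b, a) ∈ unitBall (k + 1) := by
  have h : 0 < 1 - ‖a‖ ^ 2 := by
    have : ‖a‖ ^ 2 < 1 := (sq_lt_one_iff₀ (norm_nonneg _)).2 ha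
    linarith
  simp only [sliceMap, unitBall, Set.mem_ofPred_eq, sum_norm_sq_cons, sum_norm_sq_smul,
    norm_sliceRadius_sq ha] at hb ⊢
  nlinarith

end Slicing

/-! ### Disc automorphisms and the weighted disc -/

section Disc

theorem integral_discMeasure (k : ℕ) (f : ℂ → ℂ) :
    ∫ a, f a ∂discMeasure k = ∫ a in Metric.ball 0 1, ((1 - ‖a‖ ^ 2) ^ k : ℝ) • f a := by
  rw [discMeasure, weightedMeasure, integral_withDensity_eq_integral_toReal_smul (by fun_prop)
    (by simp)]
  refine setIntegral_congr_fun Metric.isOpen_ball.measurableSet fun a ha => ?_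
  rw [mem_ball_zero_iff] at ha
  have h : ‖a‖ ^ 2 ≤ 1 := pow_le_one₀ (norm_nonneg _) ha.le
  rw [ENNReal.toReal_ofReal (pow_nonneg (by linarith) _)]

theorem integrable_discMeasure_iff (k : ℕ) (f : ℂ → ℂ) : Integrable f (discMeasure k) ↔
    IntegrableOn (fun a => ((1 - ‖a‖ ^ 2) ^ k : ℝ) • f a) (Metric.ball 0 1) := by
  rw [discMeasure, weightedMeasure, integrable_withDensity_iff_integrable_smul' (by fun_prop)
    (by simp)]
  refine integrableOn_congr_fun (fun a ha => ?_) Metric.isOpen_ball.measurableSet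
  rw [mem_ball_zero_iff] at ha
  have h : ‖a‖ ^ 2 ≤ 1 := pow_le_one₀ (norm_nonneg _) ha.le
  rw [ENNReal.toReal_ofReal (pow_nonneg (by linarith) _)]

/-- The involutive automorphism of the disc exchanging `0` and `r`. -/
def discAut (r : ℝ) (a : ℂ) : ℂ := (r - a) / (1 - r * a)

variable {r : ℝ} {a : ℂ}

theorem one_sub_mul_ne_zero (hr0 : 0 ≤ r) (hr : r < 1) (ha : ‖a‖ < 1) : (1 - r * a : ℂ) ≠ 0 := by
  intro h
  have h1 : ‖(r * a : ℂ)‖ = 1 := by rw [← sub_eq_zero.1 h, norm_one]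
  rw [norm_mul, Complex.norm_real, Real.norm_eq_abs, abs_of_nonneg hr0] at h1
  nlinarith [norm_nonneg a]

theorem one_sub_norm_discAut_sq (hr0 : 0 ≤ r) (hr : r < 1) (ha : ‖a‖ < 1) :
    1 - ‖discAut r a‖ ^ 2 = (1 - r ^ 2) * (1 - ‖a‖ ^ 2) / ‖(1 - r * a : ℂ)‖ ^ 2 := by
  have h := norm_ne_zero_iff.2 (one_sub_mul_ne_zero hr0 hr ha)
  rw [discAut, norm_div, div_pow, eq_div_iff (by positivity), sub_mul,
    div_mul_cancel₀ _ (by positivity)]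
  simp only [← Complex.normSq_eq_norm_sq, Complex.normSq_apply]
  simp
  ring

theorem norm_discAut_lt (hr0 : 0 ≤ r) (hr : r < 1) (ha : ‖a‖ < 1) : ‖discAut r a‖ < 1 := by
  have h := norm_pos_iff.2 (one_sub_mul_ne_zero hr0 hr ha)
  have h1 := one_sub_norm_discAut_sq hr0 hr ha
  have h2 : 0 < 1 - ‖a‖ ^ 2 := by
    have : ‖a‖ ^ 2 < 1 := (sq_lt_one_iff₀ (norm_nonneg _)).2 ha
    linarith
  have h3 : 0 < 1 - r ^ 2 := by nlinarith
  have h4 : 0 < (1 - r ^ 2) * (1 - ‖a‖ ^ 2) / ‖(1 - r * a : ℂ)‖ ^ 2 := by positivity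
  exact (sq_lt_one_iff₀ (norm_nonneg _)).1 (by linarith)

theorem discAut_discAut (hr0 : 0 ≤ r) (hr : r < 1) (ha : ‖a‖ < 1) :
    discAut r (discAut r a) = a := by
  have h := one_sub_mul_ne_zero hr0 hr ha
  have h3 : (1 - (r : ℂ) ^ 2) ≠ 0 := by
    have : (0 : ℝ) < 1 - r ^ 2 := by nlinarith
    exact_mod_cast this.ne'
  have h4 : (1 - r * ((r - a) / (1 - r * a)) : ℂ) = (1 - r ^ 2) / (1 - r * a) := by
    field_simp; ring
  rw [discAut, discAut, h4]
  field_simp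
  ring

theorem image_discAut (hr0 : 0 ≤ r) (hr : r < 1) :
    discAut r '' Metric.ball 0 1 = Metric.ball 0 1 := by
  ext a
  constructor
  · rintro ⟨b, hb, rfl⟩
    rw [mem_ball_zero_iff] at hb ⊢
    exact norm_discAut_lt hr0 hr hb
  · intro ha
    rw [mem_ball_zero_iff] at ha
    exact ⟨discAut r a, mem_ball_zero_iff.2 (norm_discAut_lt hr0 hr ha), discAut_discAut hr0 hr ha⟩

theorem injOn_discAut (hr0 : 0 ≤ r) (hr : r < 1) : Set.InjOn (discAut r) (Metric.ball 0 1) := by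
  intro a ha b hb h
  rw [mem_ball_zero_iff] at ha hb
  rw [← discAut_discAut hr0 hr ha, h, discAut_discAut hr0 hr hb]

theorem hasDerivAt_discAut (hr0 : 0 ≤ r) (hr : r < 1) (ha : ‖a‖ < 1) :
    HasDerivAt (discAut r) (-(1 - r ^ 2) / (1 - r * a) ^ 2) a := by
  have h := one_sub_mul_ne_zero hr0 hr ha
  have h1 : HasDerivAt (fun a : ℂ => (r - a : ℂ)) (-1) a := (hasDerivAt_id a).const_sub _
  have h2 : HasDerivAt (fun a : ℂ => (1 - r * a : ℂ)) (-(r * 1)) a :=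
    ((hasDerivAt_id a).const_mul _).const_sub _
  refine (h1.div h2 h).congr_deriv ?_
  congr 1
  ring

theorem det_restrictScalars_toSpanSingleton (c : ℂ) :
    ((ContinuousLinearMap.toSpanSingleton ℂ c).restrictScalars ℝ).det = ‖c‖ ^ 2 := by
  change LinearMap.det ((ContinuousLinearMap.toSpanSingleton ℂ c : ℂ →ₗ[ℂ] ℂ).restrictScalars ℝ) = _
  rw [LinearMap.det_restrictScalars, Algebra.norm_complex_apply, Complex.normSq_eq_norm_sq,
    LinearMap.det_ring]
  simp

/-- With `φ = discAut r`, one has `|φ'|² = (1 - r²)² / |1 - r a|⁴` and `1 - r conj φ(a) = (1 - r²) /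
(1 - r conj a)`. The powers of `1 - r²` cancel (`2 + k` against `k + 2`), as do those of `1 - r conj
a`, so the antiholomorphic kernel turns into a holomorphic one. -/
theorem discAut_jacobian_mul_weight (hr0 : 0 ≤ r) (hr : r < 1) (ha : ‖a‖ < 1) (k : ℕ) (t : ℂ) :
    (‖(-(1 - r ^ 2) / (1 - r * a) ^ 2 : ℂ)‖ ^ 2) • (((1 - ‖discAut r a‖ ^ 2) ^ k : ℝ) •
      (t * ((1 - r * conj (discAut r a)) ^ (k + 2))⁻¹)) =
    ((1 - ‖a‖ ^ 2) ^ k : ℝ) • (t * ((1 - r * a) ^ (k + 2))⁻¹) := by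
  have h := one_sub_mul_ne_zero hr0 hr ha
  have hc : (1 - r * conj a : ℂ) ≠ 0 := by
    have := (map_ne_zero (starRingEnd ℂ)).2 h
    simpa using this
  have h3 : (1 - (r : ℂ) ^ 2) ≠ 0 := by
    have : (0 : ℝ) < 1 - r ^ 2 := by nlinarith
    exact_mod_cast this.ne'
  have e1 : (1 - r * conj (discAut r a) : ℂ) = (1 - r ^ 2) / (1 - r * conj a) := by
    rw [discAut, map_div₀]
    simp only [map_sub, map_mul, map_one, Complex.conj_ofReal]
    field_simp
    ring
  have e2 : ((‖(1 - r * a : ℂ)‖ ^ 2 : ℝ) : ℂ) = (1 - r * a) * (1 - r * conj a) := by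
    rw [← Complex.normSq_eq_norm_sq, Complex.normSq_eq_conj_mul_self, mul_comm]
    simp
  have e3 : ((‖(-(1 - r ^ 2) / (1 - r * a) ^ 2 : ℂ)‖ ^ 2 : ℝ) : ℂ) =
      (1 - r ^ 2) ^ 2 / ((1 - r * a) * (1 - r * conj a)) ^ 2 := by
    rw [← e2, norm_div, norm_neg, norm_pow, div_pow]
    have : ‖(1 - r ^ 2 : ℂ)‖ = 1 - r ^ 2 := by
      have h5 : ((1 - r ^ 2 : ℝ) : ℂ) = 1 - (r : ℂ) ^ 2 := by push_cast; ring
      rw [← h5, Complex.norm_real, Real.norm_eq_abs, abs_of_pos (by nlinarith)]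
    rw [this]
    push_cast
    ring
  rw [one_sub_norm_discAut_sq hr0 hr ha, e1]
  simp only [Complex.real_smul]
  rw [e3]
  push_cast
  rw [show ((‖(1 - r * a : ℂ)‖ : ℂ) ^ 2) = (1 - r * a) * (1 - r * conj a) by
    rw [← e2]; push_cast; ring]
  simp only [div_pow, mul_pow, inv_div]
  field_simp
  ring

/-- The reproducing formula for the weighted disc. -/
theorem integral_discMeasure_reproducing (hr0 : 0 ≤ r) (hr : r < 1) (k : ℕ) {h : ℂ → ℂ}
    (hh : DifferentiableOn ℂ h (Metric.ball 0 1))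
    (hi : Integrable (fun a => h a * ((1 - r * conj a) ^ (k + 2))⁻¹) (discMeasure k)) :
    ∫ a, h a * ((1 - r * conj a) ^ (k + 2))⁻¹ ∂discMeasure k =
      (discMeasure k).real Set.univ * h r := by
  have hD : ∀ a ∈ Metric.ball (0 : ℂ) 1, HasFDerivWithinAt (discAut r)
      ((ContinuousLinearMap.toSpanSingleton ℂ
        (-(1 - r ^ 2) / (1 - r * a) ^ 2 : ℂ)).restrictScalars ℝ) (Metric.ball 0 1) a := by
    intro a ha
    rw [mem_ball_zero_iff] at ha
    exact ((hasDerivAt_discAut hr0 hr ha).hasFDerivAt.restrictScalars ℝ).hasFDerivWithinAt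
  have hms : MeasurableSet (Metric.ball (0 : ℂ) 1) := Metric.isOpen_ball.measurableSet
  have hcongr : ∀ a ∈ Metric.ball (0 : ℂ) 1,
      |((ContinuousLinearMap.toSpanSingleton ℂ
        (-(1 - r ^ 2) / (1 - r * a) ^ 2 : ℂ)).restrictScalars ℝ).det| •
        (((1 - ‖discAut r a‖ ^ 2) ^ k : ℝ) •
          (h (discAut r a) * ((1 - r * conj (discAut r a)) ^ (k + 2))⁻¹)) =
      ((1 - ‖a‖ ^ 2) ^ k : ℝ) • (h (discAut r a) * ((1 - r * a) ^ (k + 2))⁻¹) := by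
    intro a ha
    rw [mem_ball_zero_iff] at ha
    rw [det_restrictScalars_toSpanSingleton, abs_of_nonneg (by positivity)]
    exact discAut_jacobian_mul_weight hr0 hr ha k _
  set Q : ℂ → ℂ := fun a => ((1 - ‖a‖ ^ 2) ^ k : ℝ) • (h a * ((1 - r * conj a) ^ (k + 2))⁻¹)
  -- After the substitution the integrand is holomorphic times the radial weight, so the mean value
  -- property evaluates it at `0`, where `discAut r` takes the value `r`.
  have hG : DifferentiableOn ℂ (fun a => h (discAut r a) * ((1 - r * a) ^ (k + 2))⁻¹)
      (Metric.ball 0 1) := by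
    refine (hh.comp (fun a ha => ?_) fun a ha => ?_).mul
      (DifferentiableOn.inv (by fun_prop) fun a ha => pow_ne_zero _ ?_) <;>
      rw [mem_ball_zero_iff] at ha
    · exact (hasDerivAt_discAut hr0 hr ha).differentiableAt.differentiableWithinAt
    · exact mem_ball_zero_iff.2 (norm_discAut_lt hr0 hr ha)
    · exact one_sub_mul_ne_zero hr0 hr ha
  have hGi : Integrable (fun a => h (discAut r a) * ((1 - r * a) ^ (k + 2))⁻¹) (discMeasure k) := by
    rw [integrable_discMeasure_iff] at hi ⊢
    rw [← integrableOn_congr_fun hcongr hms,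
      ← integrableOn_image_iff_integrableOn_abs_det_fderiv_smul volume hms hD
        (injOn_discAut hr0 hr) Q, image_discAut hr0 hr]
    exact hi
  have h0 := integral_discMeasure_eq k hG hGi
  rw [integral_discMeasure] at h0 ⊢
  rw [← setIntegral_congr_fun hms hcongr, ← integral_image_eq_integral_abs_det_fderiv_smul volume
    hms hD (injOn_discAut hr0 hr) Q, image_discAut hr0 hr] at h0
  rw [h0]
  simp [discAut]

end Disc

/-! ### The Bergman kernel of the ball and its values on the first axis -/

section Reproducing

open Matrix

/-- The Bergman kernel of the unit ball, up to the normalizing constant. -/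
def ballKernel {m : ℕ} (z ζ : Fin m → ℂ) : ℂ := ((1 - z ⬝ᵥ star ζ) ^ (m + 1))⁻¹

theorem single_dotProduct_star {k : ℕ} (r : ℂ) (ζ : Fin (k + 1) → ℂ) :
    (Pi.single 0 r : Fin (k + 1) → ℂ) ⬝ᵥ star ζ = r * conj (ζ 0) := by
  simp

theorem norm_dotProduct_star_le {m : ℕ} (z ζ : Fin m → ℂ) :
    ‖z ⬝ᵥ star ζ‖ ≤ √(∑ i, ‖z i‖ ^ 2) * √(∑ i, ‖ζ i‖ ^ 2) := by
  refine (norm_sum_le _ _).trans ?_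
  simp only [norm_mul, Pi.star_apply, norm_star]
  exact Real.sum_mul_le_sqrt_mul_sqrt _ _ _

theorem sqrt_sum_lt_one {m : ℕ} {z : Fin m → ℂ} (hz : z ∈ unitBall m) : √(∑ i, ‖z i‖ ^ 2) < 1 := by
  rw [Real.sqrt_lt' one_pos, one_pow]
  exact hz

/-- Cauchy–Schwarz. The bound does not depend on `ζ`, so for fixed `z` the kernel is bounded and can
be integrated against `L¹` functions. -/
theorem one_sub_sqrt_le_norm {m : ℕ} (z : Fin m → ℂ) {ζ : Fin m → ℂ} (hζ : ζ ∈ unitBall m) :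
    1 - √(∑ i, ‖z i‖ ^ 2) ≤ ‖1 - z ⬝ᵥ star ζ‖ := by
  have h1 := norm_dotProduct_star_le z ζ
  have h2 := sqrt_sum_lt_one hζ
  have h3 : ‖(1 : ℂ)‖ - ‖z ⬝ᵥ star ζ‖ ≤ ‖1 - z ⬝ᵥ star ζ‖ := norm_sub_norm_le _ _
  rw [norm_one] at h3
  have h4 := mul_le_of_le_one_right (Real.sqrt_nonneg (∑ i, ‖z i‖ ^ 2)) h2.le
  linarith

theorem ballKernel_conj {m : ℕ} (z ζ : Fin m → ℂ) : conj (ballKernel z ζ) = ballKernel ζ z := by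
  simp only [ballKernel, map_inv₀, map_pow, map_sub, map_one]
  congr 3
  change star (z ⬝ᵥ star ζ) = _
  rw [← star_dotProduct_star, star_star, dotProduct_comm]

theorem norm_ballKernel_comm {m : ℕ} (z ζ : Fin m → ℂ) : ‖ballKernel z ζ‖ = ‖ballKernel ζ z‖ := by
  rw [← ballKernel_conj, RCLike.norm_conj]

theorem norm_ballKernel_le {m : ℕ} {z : Fin m → ℂ} (hz : z ∈ unitBall m) {ζ : Fin m → ℂ}
    (hζ : ζ ∈ unitBall m) : ‖ballKernel z ζ‖ ≤ ((1 - √(∑ i, ‖z i‖ ^ 2)) ^ (m + 1))⁻¹ := by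
  have h := one_sub_sqrt_le_norm z hζ
  have h0 : 0 < 1 - √(∑ i, ‖z i‖ ^ 2) := sub_pos.2 (sqrt_sum_lt_one hz)
  rw [ballKernel, norm_inv, norm_pow]
  gcongr

theorem measurable_ballKernel {m : ℕ} :
    Measurable fun x : (Fin m → ℂ) × (Fin m → ℂ) => ballKernel x.1 x.2 := by
  unfold ballKernel
  have h : Continuous fun x : (Fin m → ℂ) × (Fin m → ℂ) => x.1 ⬝ᵥ star x.2 :=
    continuous_fst.dotProduct continuous_snd.star
  have h1 : Measurable fun x : (Fin m → ℂ) × (Fin m → ℂ) => 1 - x.1 ⬝ᵥ star x.2 :=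
    (continuous_const.sub h).measurable
  exact (h1.pow_const (m + 1)).inv

theorem measurable_ballKernel_right {m : ℕ} (z : Fin m → ℂ) : Measurable (ballKernel z) :=
  Measurable.comp (g := fun x : (Fin m → ℂ) × (Fin m → ℂ) => ballKernel x.1 x.2)
    (f := fun ζ => (z, ζ)) measurable_ballKernel measurable_prodMk_left

theorem memLp_top_ballKernel {m : ℕ} {z : Fin m → ℂ} (hz : z ∈ unitBall m) :
    MemLp (ballKernel z) ∞ (volume.restrict (unitBall m)) := by
  refine memLp_top_of_bound (measurable_ballKernel_right z).aestronglyMeasurable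
    (((1 - √(∑ i, ‖z i‖ ^ 2)) ^ (m + 1))⁻¹) ?_
  filter_upwards [ae_restrict_mem (isOpen_unitBall m).measurableSet] with ζ hζ
  exact norm_ballKernel_le hz hζ

theorem integrable_mul_ballKernel {m : ℕ} {z : Fin m → ℂ} (hz : z ∈ unitBall m)
    {F : (Fin m → ℂ) → ℂ} (hF : IntegrableOn F (unitBall m)) :
    IntegrableOn (fun ζ => F ζ * ballKernel z ζ) (unitBall m) :=
  hF.mul_of_top_left (memLp_top_ballKernel hz)

theorem integral_sliceMap {k : ℕ} {G : (Fin (k + 1) → ℂ) → ℂ}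
    (hG : IntegrableOn G (unitBall (k + 1))) :
    Integrable (fun x => G (sliceMap k x)) ((volume.restrict (unitBall k)).prod (discMeasure k)) ∧
    ∫ ζ in unitBall (k + 1), G ζ =
      ∫ a, (∫ b in unitBall k, G (sliceMap k (b, a))) ∂discMeasure k := by
  have hs := measurePreserving_sliceMap k
  have hi : Integrable (fun x => G (sliceMap k x))
      ((volume.restrict (unitBall k)).prod (discMeasure k)) := (hs.integrable_comp hG.1).2 hG
  refine ⟨hi, ?_⟩
  rw [← integral_prod_symm _ hi]
  conv_lhs => rw [← hs.map_eq]
  rw [integral_map hs.measurable.aemeasurable]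
  rw [hs.map_eq]
  exact hG.1

theorem measureReal_unitBall_succ (k : ℕ) : volume.real (unitBall (k + 1)) =
    volume.real (unitBall k) * (discMeasure k).real Set.univ := by
  have h := (measurePreserving_sliceMap k).measure_preimage (s := Set.univ)
    MeasurableSet.univ.nullMeasurableSet
  rw [Set.preimage_univ, ← Set.univ_prod_univ, Measure.prod_prod] at h
  simp only [Measure.restrict_apply_univ] at h
  rw [Measure.real, ← h, ENNReal.toReal_mul]
  rfl

theorem cons_mem_unitBall (k : ℕ) {a : ℂ} (ha : a ∈ Metric.ball (0 : ℂ) 1) :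
    (Pi.single 0 a : Fin (k + 1) → ℂ) ∈ unitBall (k + 1) := by
  rw [mem_ball_zero_iff] at ha
  simp [unitBall, Fin.sum_univ_succ, ha]

theorem sliceMap_zero (k : ℕ) (a : ℂ) : sliceMap k (0, a) = Pi.single 0 a := by
  ext i
  refine Fin.cases ?_ (fun j => ?_) i <;> simp [sliceMap]

theorem ballKernel_single_sliceMap {k : ℕ} (r : ℂ) (b : Fin k → ℂ) (a : ℂ) :
    ballKernel (Pi.single 0 r) (sliceMap k (b, a)) = ((1 - r * conj a) ^ (k + 2))⁻¹ := by
  rw [ballKernel, single_dotProduct_star]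
  simp [sliceMap]

/-- At a point of the first axis the kernel depends only on the first coordinate `a` of `ζ`. For
fixed `a` the slice map is linear up to translation in `b`, so the mean value property over the ball
of `ℂ^k` replaces `F` by its value at `(a, 0)`. What is left is the reproducing formula of the disc
with weight exponent `k` and kernel exponent `k + 2`. -/
theorem integral_mul_ballKernel_single {k : ℕ} {r : ℝ} (hr0 : 0 ≤ r) (hr : r < 1)
    {F : (Fin (k + 1) → ℂ) → ℂ} (hF : DifferentiableOn ℂ F (unitBall (k + 1)))
    (hFi : IntegrableOn F (unitBall (k + 1))) :
    ∫ ζ in unitBall (k + 1), F ζ * ballKernel (Pi.single 0 (r : ℂ)) ζ =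
      volume.real (unitBall (k + 1)) * F (Pi.single 0 (r : ℂ)) := by
  have hz : (Pi.single 0 (r : ℂ) : Fin (k + 1) → ℂ) ∈ unitBall (k + 1) :=
    cons_mem_unitBall k (by simpa [abs_of_nonneg hr0] using hr)
  obtain ⟨hi, heq⟩ := integral_sliceMap (integrable_mul_ballKernel hz hFi)
  have hinner : ∀ᵐ a ∂discMeasure k, ∫ b in unitBall k, F (sliceMap k (b, a)) *
      ballKernel (Pi.single 0 (r : ℂ)) (sliceMap k (b, a)) = volume.real (unitBall k) *
        (F (Pi.single 0 a) * ((1 - r * conj a) ^ (k + 2))⁻¹) := by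
    filter_upwards [hi.prod_left_ae, ae_discMeasure_mem k] with a ha hmem
    have hmem' := hmem
    rw [mem_ball_zero_iff] at hmem'
    rw [integral_unitBall_eq k ?_ ha, ballKernel_single_sliceMap, sliceMap_zero]
    simp_rw [ballKernel_single_sliceMap]
    refine DifferentiableOn.mul_const (hF.comp ?_ fun b hb => sliceMap_mem hb hmem') _
    refine differentiableOn_pi.2 fun i => ?_
    refine Fin.cases ?_ (fun j => ?_) i
    · simp [sliceMap]
    · simp only [sliceMap, Fin.cons_succ, Pi.smul_apply]
      fun_prop
  have hv : (volume.real (unitBall k) : ℂ) ≠ 0 := by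
    rw [Complex.ofReal_ne_zero, Measure.real, ENNReal.toReal_ne_zero]
    exact ⟨volume_unitBall_ne_zero k, volume_unitBall_ne_top k⟩
  -- Fubini already gives integrability of the inner integrals; dividing by the nonzero volume of
  -- the ball of `ℂ^k` transfers it to the disc integrand.
  have hint : Integrable (fun a => F (Pi.single 0 a) * ((1 - r * conj a) ^ (k + 2))⁻¹)
      (discMeasure k) := by
    have h1 := (hi.integral_prod_right).congr hinner
    exact (integrable_const_mul_iff (isUnit_iff_ne_zero.2 hv) _).1 h1
  have hd : DifferentiableOn ℂ (fun a : ℂ => F (Pi.single 0 a)) (Metric.ball 0 1) := by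
    refine hF.comp ?_ fun a ha => cons_mem_unitBall k ha
    refine differentiableOn_pi.2 fun i => ?_
    refine Fin.cases ?_ (fun j => ?_) i
    · simpa using! differentiableOn_id
    · simp
  rw [heq, integral_congr_ae hinner, integral_const_mul,
    integral_discMeasure_reproducing hr0 hr k hd hint, measureReal_unitBall_succ]
  push_cast
  ring

theorem exists_unitary_mulVec_single {k : ℕ} (z : Fin (k + 1) → ℂ) :
    ∃ U ∈ Matrix.unitaryGroup (Fin (k + 1)) ℂ,
      U *ᵥ (Pi.single 0 ((√(∑ i, ‖z i‖ ^ 2) : ℝ) : ℂ)) = z := by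
  by_cases hz : z = 0
  · exact ⟨1, one_mem _, by simp [hz]⟩
  set v : EuclideanSpace ℂ (Fin (k + 1)) := WithLp.toLp 2 z with hv
  have hvn : ‖v‖ = √(∑ i, ‖z i‖ ^ 2) := by rw [EuclideanSpace.norm_eq]
  have hv0 : ‖v‖ ≠ 0 := by
    rw [norm_ne_zero_iff]
    intro h
    apply hz
    have := congrArg WithLp.ofLp h
    simpa [hv] using this
  -- The normalised vector `z / |z|` extends to an orthonormal basis; the matrix with these columns
  -- sends the first axis to the line of `z`.
  have horth : Orthonormal ℂ (({0} : Set (Fin (k + 1))).domRestrict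
      fun _ => ((‖v‖⁻¹ : ℝ) : ℂ) • v) := by
    refine ⟨fun i => ?_, fun i j hij => (hij (Subsingleton.elim _ _)).elim⟩
    simp [norm_smul, hv0]
  obtain ⟨b, hb⟩ := horth.exists_orthonormalBasis_extension_of_card_eq (by simp)
  refine ⟨(EuclideanSpace.basisFun (Fin (k + 1)) ℂ).toBasis.toMatrix b,
    OrthonormalBasis.toMatrix_orthonormalBasis_mem_unitary _ _, ?_⟩
  ext i
  rw [← hvn, Matrix.mulVec_single]
  simp only [MulOpposite.smul_eq_mul_unop, Matrix.col_apply, Pi.smul_apply, Module.Basis.toMatrix_apply, hb 0 rfl]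
  have hv0' : ((‖v‖ : ℝ) : ℂ) ≠ 0 := Complex.ofReal_ne_zero.2 hv0
  simp only [OrthonormalBasis.coe_toBasis_repr_apply, EuclideanSpace.basisFun_repr,
    PiLp.smul_apply, smul_eq_mul, hv, Complex.ofReal_inv, MulOpposite.unop_op] at hv0' ⊢
  field_simp

end Reproducing

/-! ### Unitary invariance and the reproducing formula -/

section Unitary

open Matrix

variable {m : ℕ} {U : Matrix (Fin m) (Fin m) ℂ}

theorem mulVec_dotProduct_star_mulVec (hU : U ∈ Matrix.unitaryGroup (Fin m) ℂ) (u v : Fin m → ℂ) :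
    (U *ᵥ u) ⬝ᵥ star (U *ᵥ v) = u ⬝ᵥ star v := by
  have h : Uᴴ * U = 1 := Matrix.mem_unitaryGroup_iff'.1 hU
  rw [star_mulVec, dotProduct_comm, dotProduct_mulVec, vecMul_vecMul, h, vecMul_one,
    dotProduct_comm]

theorem dotProduct_star_self_eq (v : Fin m → ℂ) : v ⬝ᵥ star v = ((∑ i, ‖v i‖ ^ 2 : ℝ) : ℂ) := by
  simp [dotProduct, Complex.mul_conj, Complex.normSq_eq_norm_sq]

theorem sum_norm_sq_mulVec (hU : U ∈ Matrix.unitaryGroup (Fin m) ℂ) (v : Fin m → ℂ) :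
    ∑ i, ‖(U *ᵥ v) i‖ ^ 2 = ∑ i, ‖v i‖ ^ 2 := by
  have h := mulVec_dotProduct_star_mulVec hU v v
  rw [dotProduct_star_self_eq, dotProduct_star_self_eq] at h
  exact_mod_cast h

theorem ballKernel_mulVec (hU : U ∈ Matrix.unitaryGroup (Fin m) ℂ) (u v : Fin m → ℂ) :
    ballKernel (U *ᵥ u) (U *ᵥ v) = ballKernel u v := by
  rw [ballKernel, mulVec_dotProduct_star_mulVec hU, ballKernel]

theorem mulVec_mem_unitBall_iff (hU : U ∈ Matrix.unitaryGroup (Fin m) ℂ) (v : Fin m → ℂ) :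
    U *ᵥ v ∈ unitBall m ↔ v ∈ unitBall m := by
  simp only [unitBall, Set.mem_ofPred_eq, sum_norm_sq_mulVec hU]

theorem measurePreserving_mulVec_unitBall (hU : U ∈ Matrix.unitaryGroup (Fin m) ℂ) :
    MeasurePreserving (fun v => U *ᵥ v) (volume.restrict (unitBall m))
      (volume.restrict (unitBall m)) := by
  have hdet : ‖LinearMap.det (Matrix.toLin' U)‖ = 1 := by
    rw [LinearMap.det_toLin']
    exact CStarRing.norm_of_mem_unitary (Matrix.det_of_mem_unitary hU)
  have h := (measurePreserving_of_norm_det_eq_one volume (Matrix.toLin' U) hdet).restrict_preimage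
    (isOpen_unitBall m).measurableSet
  have e : (Matrix.toLin' U) ⁻¹' unitBall m = unitBall m := by
    ext v
    simp only [Set.mem_preimage, Matrix.toLin'_apply, mulVec_mem_unitBall_iff hU]
  rw [e] at h
  exact h

/-- The reproducing formula for the unit ball. -/
theorem integral_mul_ballKernel {z : Fin m → ℂ} (hz : z ∈ unitBall m) {F : (Fin m → ℂ) → ℂ}
    (hF : DifferentiableOn ℂ F (unitBall m)) (hFi : IntegrableOn F (unitBall m)) :
    ∫ ζ in unitBall m, F ζ * ballKernel z ζ = volume.real (unitBall m) * F z := by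
  cases m with
  | zero =>
    have h : ∀ ζ, F ζ * ballKernel z ζ = F z := fun ζ => by
      rw [Subsingleton.elim ζ z]
      simp [ballKernel]
    simp_rw [h]
    simp
  | succ k =>
    -- The ball, its measure and its kernel are all unitarily invariant, so `z` may be rotated onto
    -- the first axis.
    obtain ⟨U, hU, hUz⟩ := exists_unitary_mulVec_single z
    have hp := measurePreserving_mulVec_unitBall hU
    have hr := sqrt_sum_lt_one hz
    set r : ℝ := √(∑ i, ‖z i‖ ^ 2)
    have hd : DifferentiableOn ℂ (fun v => F (U *ᵥ v)) (unitBall (k + 1)) :=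
      hF.comp (LinearMap.toContinuousLinearMap (Matrix.toLin' U)).differentiableOn
        fun v hv => (mulVec_mem_unitBall_iff hU v).2 hv
    have hi : IntegrableOn (fun v => F (U *ᵥ v)) (unitBall (k + 1)) :=
      (hp.integrable_comp hFi.1).2 hFi
    have h1 := integral_mul_ballKernel_single (Real.sqrt_nonneg _) hr hd hi
    rw [hUz] at h1
    rw [← h1]
    conv_lhs => rw [← hp.map_eq]
    rw [integral_map hp.measurable.aemeasurable]
    · refine integral_congr_ae (Eventually.of_forall fun v => ?_)
      simp only
      congr 1
      conv_lhs => rw [← hUz]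
      exact ballKernel_mulVec hU _ _
    · rw [hp.map_eq]
      exact (integrable_mul_ballKernel hz hFi).1

end Unitary

/-! ### The Forelli–Rudin estimate on the disc -/

section RadialEstimate

/-- Split at `t = δ`. Below it the integrand is at most `t^(-ε) / δ`, integrable because `ε < 1`;
above it, at most `t^(-ε-1)`, integrable at infinity because `ε > 0`. Both parts scale like
`δ^(-ε)`. -/
theorem lintegral_rpow_div_max_le {ε : ℝ} (hε0 : 0 < ε) (hε1 : ε < 1) {δ : ℝ} (hδ : 0 < δ) :
    ∫⁻ t in Set.Ioo (0 : ℝ) 1, ENNReal.ofReal (t ^ (-ε) / max t δ) ≤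
      ENNReal.ofReal ((1 / (1 - ε) + 1 / ε) * δ ^ (-ε)) := by
  have h1 : ∫⁻ t in Set.Ioc (0 : ℝ) δ, ENNReal.ofReal (t ^ (-ε) / max t δ) ≤
      ENNReal.ofReal (1 / (1 - ε) * δ ^ (-ε)) := by
    have hint : IntegrableOn (fun t : ℝ => t ^ (-ε) / δ) (Set.Ioc 0 δ) := by
      have := (intervalIntegral.intervalIntegrable_rpow' (a := 0) (b := δ) (r := -ε)
        (by linarith)).div_const δ
      exact (intervalIntegrable_iff_integrableOn_Ioc_of_le hδ.le).1 this
    calc _ ≤ ∫⁻ t in Set.Ioc (0 : ℝ) δ, ENNReal.ofReal (t ^ (-ε) / δ) := by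
          refine setLIntegral_mono' measurableSet_Ioc fun t ht => ENNReal.ofReal_le_ofReal ?_
          have := Real.rpow_nonneg ht.1.le (-ε)
          gcongr
          exact le_max_right _ _
      _ = ENNReal.ofReal (∫ t in Set.Ioc (0 : ℝ) δ, t ^ (-ε) / δ) := by
          rw [ofReal_integral_eq_lintegral_ofReal hint]
          filter_upwards [ae_restrict_mem measurableSet_Ioc] with t ht
          have := Real.rpow_nonneg ht.1.le (-ε)
          simp only [Pi.zero_apply]
          positivity
      _ = _ := by
          congr 1
          rw [← intervalIntegral.integral_of_le hδ.le, intervalIntegral.integral_div,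
            integral_rpow (Or.inl (by linarith)), Real.zero_rpow (by linarith),
            Real.rpow_add hδ, Real.rpow_one]
          have : 1 - ε ≠ 0 := by linarith
          have h2 : -ε + 1 ≠ 0 := by linarith
          field_simp
          ring
  have h2 : ∫⁻ t in Set.Ioi δ, ENNReal.ofReal (t ^ (-ε) / max t δ) ≤
      ENNReal.ofReal (1 / ε * δ ^ (-ε)) := by
    have hint : IntegrableOn (fun t : ℝ => t ^ (-ε - 1)) (Set.Ioi δ) :=
      integrableOn_Ioi_rpow_of_lt (by linarith) hδ
    calc _ ≤ ∫⁻ t in Set.Ioi δ, ENNReal.ofReal (t ^ (-ε - 1)) := by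
          refine setLIntegral_mono' measurableSet_Ioi fun t ht => ENNReal.ofReal_le_ofReal ?_
          have ht0 : 0 < t := hδ.trans ht
          have := Real.rpow_nonneg ht0.le (-ε)
          rw [Real.rpow_sub_one ht0.ne']
          gcongr
          exact le_max_left _ _
      _ = ENNReal.ofReal (∫ t in Set.Ioi δ, t ^ (-ε - 1)) := by
          rw [ofReal_integral_eq_lintegral_ofReal hint]
          filter_upwards [ae_restrict_mem measurableSet_Ioi] with t ht
          exact Real.rpow_nonneg (hδ.trans ht).le _
      _ = _ := by
          congr 1
          rw [integral_Ioi_rpow_of_lt (by linarith) hδ, sub_add_cancel]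
          field_simp
  calc _ ≤ ∫⁻ t in Set.Ioc (0 : ℝ) δ ∪ Set.Ioi δ, ENNReal.ofReal (t ^ (-ε) / max t δ) := by
        refine lintegral_mono_set fun t ht => ?_
        by_cases h : t ≤ δ
        · exact Or.inl ⟨ht.1, h⟩
        · exact Or.inr (not_le.1 h)
    _ ≤ _ := lintegral_union_le _ _ _
    _ ≤ _ := add_le_add h1 h2
    _ = _ := by
        have : 0 < 1 - ε := by linarith
        rw [← ENNReal.ofReal_add (by positivity) (by positivity), add_mul]

/-- On the unit circle `|1 - w e^{iθ}| = |e^{iθ} - w|` for real `w`, so after multiplication by `1 -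
w²` the integrand is the Poisson kernel at `w`, of circle average `1`. -/
theorem integral_inv_norm_one_sub_sq {w : ℝ} (hw0 : 0 ≤ w) (hw : w < 1) :
    ∫ θ in -Real.pi..Real.pi, (‖(1 - w * circleMap 0 1 θ : ℂ)‖ ^ 2)⁻¹ =
      2 * Real.pi / (1 - w ^ 2) := by
  have hw2 : 0 < 1 - w ^ 2 := by nlinarith
  have hper : Function.Periodic (fun θ : ℝ => (‖(1 - w * circleMap 0 1 θ : ℂ)‖ ^ 2)⁻¹)
      (2 * Real.pi) := fun θ => by simp only [periodic_circleMap 0 1 θ]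
  have h1 := hper.intervalIntegral_add_eq (-Real.pi) 0
  rw [show -Real.pi + 2 * Real.pi = Real.pi by ring, zero_add] at h1
  rw [h1]
  have hmem : (w : ℂ) ∈ Metric.ball (0 : ℂ) 1 := by
    simpa [abs_of_nonneg hw0] using hw
  have h2 := DiffContOnCl.circleAverage_poissonKernel_smul' (f := fun _ => (1 : ℝ) • (1 : ℂ))
    (c := 0) (R := 1) diffContOnCl_const hmem
  have h3 : ∀ θ : ℝ, (‖circleMap 0 1 θ - 0‖ ^ 2 - ‖(w : ℂ) - 0‖ ^ 2) /
      ‖circleMap 0 1 θ - 0 - ((w : ℂ) - 0)‖ ^ 2 =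
      (1 - w ^ 2) * (‖(1 - w * circleMap 0 1 θ : ℂ)‖ ^ 2)⁻¹ := by
    intro θ
    have hn : ‖circleMap 0 1 θ‖ = 1 := by simp
    have e : ‖circleMap 0 1 θ - w‖ ^ 2 = ‖(1 - w * circleMap 0 1 θ : ℂ)‖ ^ 2 := by
      have hn2 : ‖circleMap 0 1 θ‖ ^ 2 = 1 := by rw [hn, one_pow]
      rw [← Complex.normSq_eq_norm_sq, Complex.normSq_apply] at hn2 ⊢
      rw [← Complex.normSq_eq_norm_sq, Complex.normSq_apply]
      simp only [Complex.sub_re, Complex.sub_im, Complex.ofReal_re, Complex.ofReal_im,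
        Complex.one_re, Complex.one_im, Complex.mul_re, Complex.mul_im]
      linear_combination (1 - w ^ 2) * hn2
    simp only [sub_zero, hn, e, Complex.norm_real, Real.norm_eq_abs, sq_abs]
    rw [one_pow, div_eq_mul_inv]
  rw [Real.circleAverage] at h2
  simp only [h3, one_smul, Complex.real_smul, mul_one] at h2
  rw [intervalIntegral.integral_ofReal, intervalIntegral.integral_const_mul,
    ← Complex.ofReal_mul] at h2
  have h4 : (2 * Real.pi)⁻¹ * ((1 - w ^ 2) *
      ∫ θ in (0 : ℝ)..2 * Real.pi, (‖(1 - w * circleMap 0 1 θ : ℂ)‖ ^ 2)⁻¹) = 1 := by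
    exact_mod_cast h2
  have := Real.pi_pos
  field_simp at h4 ⊢
  linarith

theorem lintegral_inv_norm_one_sub_sq {w : ℝ} (hw0 : 0 ≤ w) (hw : w < 1) :
    ∫⁻ θ in Set.Ioo (-Real.pi) Real.pi,
      ENNReal.ofReal ((‖(1 - w * circleMap 0 1 θ : ℂ)‖ ^ 2)⁻¹) =
      ENNReal.ofReal (2 * Real.pi / (1 - w ^ 2)) := by
  have hne : ∀ θ : ℝ, ‖(1 - w * circleMap 0 1 θ : ℂ)‖ ^ 2 ≠ 0 := fun θ => by
    refine pow_ne_zero _ (norm_ne_zero_iff.2 fun h => ?_)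
    have h1 : ‖(w * circleMap 0 1 θ : ℂ)‖ = 1 := by rw [← sub_eq_zero.1 h, norm_one]
    rw [norm_mul, Complex.norm_real, Real.norm_eq_abs, abs_of_nonneg hw0] at h1
    simp at h1
    linarith
  have hcont : Continuous fun θ : ℝ => (‖(1 - w * circleMap 0 1 θ : ℂ)‖ ^ 2)⁻¹ := by
    refine Continuous.inv₀ ?_ hne
    fun_prop
  have hpi : -Real.pi ≤ Real.pi := by linarith [Real.pi_pos]
  rw [← integral_inv_norm_one_sub_sq hw0 hw, intervalIntegral.integral_of_le hpi,
    ofReal_integral_eq_lintegral_ofReal, restrict_Ioo_eq_restrict_Ioc]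
  · exact (intervalIntegrable_iff_integrableOn_Ioc_of_le hpi).1 (hcont.intervalIntegrable _ _)
  · exact Eventually.of_forall fun θ => by simp only [Pi.zero_apply]; positivity

/-- The Forelli–Rudin estimate for the disc. -/
theorem lintegral_disc_le {ε : ℝ} (hε0 : 0 < ε) (hε1 : ε < 1) {r : ℝ} (hr0 : 0 ≤ r) (hr : r < 1) :
    ∫⁻ a in Metric.ball (0 : ℂ) 1,
      ENNReal.ofReal ((‖(1 - r * a : ℂ)‖ ^ 2)⁻¹ * (1 - ‖a‖ ^ 2) ^ (-ε)) ≤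
      ENNReal.ofReal (2 * Real.pi * ((1 / (1 - ε) + 1 / ε) * (1 - r) ^ (-ε))) := by
  have hball : ∀ p ∈ polarCoord.target, (Metric.ball (0 : ℂ) 1).indicator
      (fun a => ENNReal.ofReal ((‖(1 - r * a : ℂ)‖ ^ 2)⁻¹ * (1 - ‖a‖ ^ 2) ^ (-ε)))
        (Complex.polarCoord.symm p) = (Set.Ioo (0 : ℝ) 1).indicator (fun ρ : ℝ =>
        ENNReal.ofReal ((‖(1 - (r * ρ : ℝ) * circleMap 0 1 p.2 : ℂ)‖ ^ 2)⁻¹) *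
          ENNReal.ofReal ((1 - ρ ^ 2) ^ (-ε))) p.1 := by
    rintro ⟨ρ, θ⟩ hp
    have hρ : 0 < ρ := hp.1
    have e : Complex.polarCoord.symm (ρ, θ) = ρ * circleMap 0 1 θ := by
      rw [Complex.polarCoord_symm_apply, circleMap, Complex.exp_mul_I]
      simp
    have hn : ‖(ρ * circleMap 0 1 θ : ℂ)‖ = ρ := by
      rw [norm_mul, Complex.norm_real, Real.norm_eq_abs, abs_of_pos hρ]
      simp
    rw [e]
    by_cases h1 : ρ < 1
    · rw [Set.indicator_of_mem (by rwa [mem_ball_zero_iff, hn]),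
        Set.indicator_of_mem (show ρ ∈ Set.Ioo (0 : ℝ) 1 from ⟨hρ, h1⟩), hn,
        ENNReal.ofReal_mul (by positivity)]
      push_cast
      rw [mul_assoc]
    · rw [Set.indicator_of_notMem (by rwa [mem_ball_zero_iff, hn]),
        Set.indicator_of_notMem (fun h => h1 h.2)]
  have hmeas : Measurable fun p : ℝ × ℝ => ENNReal.ofReal p.1 *
      (Set.Ioo (0 : ℝ) 1).indicator (fun ρ : ℝ =>
        ENNReal.ofReal ((‖(1 - (r * ρ : ℝ) * circleMap 0 1 p.2 : ℂ)‖ ^ 2)⁻¹) *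
          ENNReal.ofReal ((1 - ρ ^ 2) ^ (-ε))) p.1 := by
    simp only [Set.indicator_apply]
    refine measurable_fst.ennreal_ofReal.mul
      (Measurable.ite (measurable_fst measurableSet_Ioo) ?_ measurable_const)
    have hc : Continuous fun p : ℝ × ℝ => (1 - (r * p.1 : ℝ) * circleMap 0 1 p.2 : ℂ) := by
      fun_prop
    exact ((hc.norm.pow 2).measurable.inv.ennreal_ofReal).mul
      (Measurable.ennreal_ofReal (by fun_prop))
  -- The angular integral is explicit, and with `t = 1 - ρ` it is dominated through `1 - ρ² ≥ 1 - ρ`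
  -- and `1 - (r ρ)² ≥ max (1 - ρ) (1 - r)`.
  have hinner : ∀ ρ : ℝ, ∫⁻ θ in Set.Ioo (-Real.pi) Real.pi, ENNReal.ofReal ρ *
      (Set.Ioo (0 : ℝ) 1).indicator (fun ρ : ℝ =>
        ENNReal.ofReal ((‖(1 - (r * ρ : ℝ) * circleMap 0 1 θ : ℂ)‖ ^ 2)⁻¹) *
          ENNReal.ofReal ((1 - ρ ^ 2) ^ (-ε))) ρ ≤
      ENNReal.ofReal (2 * Real.pi) * (Set.Ioo (0 : ℝ) 1).indicator (fun t =>
        ENNReal.ofReal (t ^ (-ε) / max t (1 - r))) (1 - ρ) := by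
    intro ρ
    by_cases hρ : ρ ∈ Set.Ioo (0 : ℝ) 1
    · have hρ' : 1 - ρ ∈ Set.Ioo (0 : ℝ) 1 := ⟨by linarith [hρ.2], by linarith [hρ.1]⟩
      obtain ⟨h0, h1⟩ := hρ
      have hrρ : r * ρ < 1 := by nlinarith
      have hrρ0 : 0 ≤ r * ρ := by positivity
      simp only [Set.indicator_of_mem (show ρ ∈ Set.Ioo (0 : ℝ) 1 from ⟨h0, h1⟩),
        Set.indicator_of_mem hρ']
      rw [lintegral_const_mul' _ _ ENNReal.ofReal_ne_top,
        lintegral_mul_const' _ _ ENNReal.ofReal_ne_top, lintegral_inv_norm_one_sub_sq hrρ0 hrρ,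
        ← ENNReal.ofReal_mul (by have := Real.pi_pos; have : 0 < 1 - (r * ρ) ^ 2 := by
                                   nlinarith
                                 positivity), ← ENNReal.ofReal_mul h0.le,
        ← ENNReal.ofReal_mul (by positivity)]
      refine ENNReal.ofReal_le_ofReal ?_
      have hpos : 0 < 1 - ρ := by linarith
      have hA : (1 - ρ ^ 2) ^ (-ε) ≤ (1 - ρ) ^ (-ε) :=
        Real.rpow_le_rpow_of_nonpos hpos (by nlinarith) (by linarith)
      have hB : max (1 - ρ) (1 - r) ≤ 1 - (r * ρ) ^ 2 := by
        refine max_le ?_ ?_ <;> nlinarith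
      have hM : 0 < max (1 - ρ) (1 - r) := lt_max_of_lt_left hpos
      have hA0 : 0 ≤ (1 - ρ ^ 2) ^ (-ε) := Real.rpow_nonneg (by nlinarith) _
      calc ρ * (2 * Real.pi / (1 - (r * ρ) ^ 2) * (1 - ρ ^ 2) ^ (-ε))
          ≤ 1 * (2 * Real.pi / max (1 - ρ) (1 - r) * (1 - ρ) ^ (-ε)) := by
            have := Real.pi_pos
            have h2 : 0 < 1 - (r * ρ) ^ 2 := hM.trans_le hB
            gcongr
        _ = _ := by ring
    · have h2 : ∀ θ : ℝ, ENNReal.ofReal ρ * (Set.Ioo (0 : ℝ) 1).indicator (fun ρ : ℝ =>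
          ENNReal.ofReal ((‖(1 - (r * ρ : ℝ) * circleMap 0 1 θ : ℂ)‖ ^ 2)⁻¹) *
            ENNReal.ofReal ((1 - ρ ^ 2) ^ (-ε))) ρ = 0 := fun θ => by
        rw [Set.indicator_of_notMem hρ, mul_zero]
      simp_rw [h2]
      simp
  rw [← lintegral_indicator Metric.isOpen_ball.measurableSet,
    ← Complex.lintegral_comp_polarCoord_symm]
  calc _ = ∫⁻ p in polarCoord.target, ENNReal.ofReal p.1 *
      (Set.Ioo (0 : ℝ) 1).indicator (fun ρ : ℝ =>
        ENNReal.ofReal ((‖(1 - (r * ρ : ℝ) * circleMap 0 1 p.2 : ℂ)‖ ^ 2)⁻¹) *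
          ENNReal.ofReal ((1 - ρ ^ 2) ^ (-ε))) p.1 :=
        setLIntegral_congr_fun polarCoord.open_target.measurableSet fun p hp => by
          simp only [smul_eq_mul]
          rw [hball p hp]
    _ = ∫⁻ ρ in Set.Ioi (0 : ℝ), ∫⁻ θ in Set.Ioo (-Real.pi) Real.pi, ENNReal.ofReal ρ *
      (Set.Ioo (0 : ℝ) 1).indicator (fun ρ : ℝ =>
        ENNReal.ofReal ((‖(1 - (r * ρ : ℝ) * circleMap 0 1 θ : ℂ)‖ ^ 2)⁻¹) *
          ENNReal.ofReal ((1 - ρ ^ 2) ^ (-ε))) ρ := by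
        rw [polarCoord_target, Measure.volume_eq_prod, ← Measure.prod_restrict,
          lintegral_prod _ hmeas.aemeasurable]
    _ ≤ ∫⁻ ρ in Set.Ioi (0 : ℝ), ENNReal.ofReal (2 * Real.pi) *
        (Set.Ioo (0 : ℝ) 1).indicator (fun t =>
          ENNReal.ofReal (t ^ (-ε) / max t (1 - r))) (1 - ρ) := lintegral_mono hinner
    _ ≤ ∫⁻ ρ : ℝ, ENNReal.ofReal (2 * Real.pi) * (Set.Ioo (0 : ℝ) 1).indicator (fun t =>
          ENNReal.ofReal (t ^ (-ε) / max t (1 - r))) (1 - ρ) := setLIntegral_le_lintegral _ _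
    _ = ENNReal.ofReal (2 * Real.pi) *
        ∫⁻ t in Set.Ioo (0 : ℝ) 1, ENNReal.ofReal (t ^ (-ε) / max t (1 - r)) := by
        rw [lintegral_const_mul' _ _ ENNReal.ofReal_ne_top,
          lintegral_sub_left_eq_self (fun t => (Set.Ioo (0 : ℝ) 1).indicator (fun t =>
            ENNReal.ofReal (t ^ (-ε) / max t (1 - r))) t), lintegral_indicator measurableSet_Ioo]
    _ ≤ _ := by
        rw [ENNReal.ofReal_mul (p := 2 * Real.pi) (by positivity)]
        exact mul_le_mul' le_rfl (lintegral_rpow_div_max_le hε0 hε1 (sub_pos.2 hr))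

end RadialEstimate

/-- The Schur test. -/
theorem lintegral_schur_test {X : Type*} [MeasurableSpace X] {ν : Measure X} [SFinite ν]
    {K : X × X → ℝ≥0∞} (hK : Measurable K) {p q : ℝ} (hpq : p.HolderConjugate q) {φ : X → ℝ≥0∞}
    (hφ : Measurable φ) (hφ0 : ∀ᵐ x ∂ν, φ x ≠ 0) (hφt : ∀ᵐ x ∂ν, φ x ≠ ∞) {A B : ℝ≥0∞}
    (hA : ∀ᵐ x ∂ν, ∫⁻ y, K (x, y) * φ y ^ q ∂ν ≤ A * φ x ^ q)
    (hB : ∀ᵐ y ∂ν, ∫⁻ x, K (x, y) * φ x ^ p ∂ν ≤ B * φ y ^ p)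
    {f : X → ℝ≥0∞} (hf : AEMeasurable f ν) :
    ∫⁻ x, (∫⁻ y, K (x, y) * f y ∂ν) ^ p ∂ν ≤ A ^ (p / q) * B * ∫⁻ y, f y ^ p ∂ν := by
  have hp := hpq.pos
  have hq := hpq.symm.pos
  have hpq1 : 1 / q + 1 / p = 1 := by
    have := hpq.inv_add_inv_eq_one
    rw [one_div, one_div]; linarith
  have hKx : ∀ x, Measurable fun y => K (x, y) := fun x => hK.comp measurable_prodMk_left
  have hpt : ∀ᵐ x ∂ν, (∫⁻ y, K (x, y) * f y ∂ν) ^ p ≤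
      A ^ (p / q) * ∫⁻ y, φ x ^ p * (K (x, y) * (φ y ^ (-p) * f y ^ p)) ∂ν := by
    filter_upwards [hA, hφt] with x hx hxt
    -- Hölder's inequality for the factorisation `K f = (K^(1/q) φ) (K^(1/p) φ⁻¹ f)`.
    have h1 : ∫⁻ y, K (x, y) * f y ∂ν ≤ (∫⁻ y, K (x, y) * φ y ^ q ∂ν) ^ (1 / q) *
        (∫⁻ y, K (x, y) * (φ y ^ (-p) * f y ^ p) ∂ν) ^ (1 / p) := by
      have hm1 : AEMeasurable (fun y => K (x, y) ^ (1 / q) * φ y) ν :=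
        (((hKx x).pow_const _).mul hφ).aemeasurable
      have hm2 : AEMeasurable (fun y => K (x, y) ^ (1 / p) * ((φ y)⁻¹ * f y)) ν :=
        ((hKx x).pow_const _).aemeasurable.mul (hφ.inv.aemeasurable.mul hf)
      have h := ENNReal.lintegral_mul_le_Lp_mul_Lq ν hpq.symm hm1 hm2
      have e1 : ∀ y, (K (x, y) ^ (1 / q) * φ y) ^ q = K (x, y) * φ y ^ q := fun y => by
        rw [ENNReal.mul_rpow_of_nonneg _ _ hq.le, ← ENNReal.rpow_mul, one_div,
          inv_mul_cancel₀ hq.ne', ENNReal.rpow_one]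
      have e2 : ∀ y, (K (x, y) ^ (1 / p) * ((φ y)⁻¹ * f y)) ^ p =
          K (x, y) * (φ y ^ (-p) * f y ^ p) := fun y => by
        rw [ENNReal.mul_rpow_of_nonneg _ _ hp.le, ENNReal.mul_rpow_of_nonneg _ _ hp.le,
          ← ENNReal.rpow_mul, one_div, inv_mul_cancel₀ hp.ne', ENNReal.rpow_one,
          ENNReal.inv_rpow, ENNReal.rpow_neg]
      simp only [Pi.mul_apply, e1, e2] at h
      refine le_trans (le_of_eq (lintegral_congr_ae ?_)) h
      filter_upwards [hφ0, hφt] with y hy0 hyt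
      calc K (x, y) * f y = K (x, y) ^ (1 / q + 1 / p) * ((φ y * (φ y)⁻¹) * f y) := by
            rw [hpq1, ENNReal.rpow_one, ENNReal.mul_inv_cancel hy0 hyt, one_mul]
        _ = _ := by
            rw [ENNReal.rpow_add_of_nonneg _ _ (by positivity) (by positivity)]
            ring
    calc (∫⁻ y, K (x, y) * f y ∂ν) ^ p
        ≤ ((A * φ x ^ q) ^ (1 / q) *
          (∫⁻ y, K (x, y) * (φ y ^ (-p) * f y ^ p) ∂ν) ^ (1 / p)) ^ p := by
          refine ENNReal.rpow_le_rpow (h1.trans ?_) hp.le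
          exact mul_le_mul' (ENNReal.rpow_le_rpow hx (by positivity)) le_rfl
      _ = A ^ (p / q) * (φ x ^ p * ∫⁻ y, K (x, y) * (φ y ^ (-p) * f y ^ p) ∂ν) := by
          rw [ENNReal.mul_rpow_of_nonneg _ _ hp.le, ENNReal.mul_rpow_of_nonneg _ _ (by positivity),
            ENNReal.mul_rpow_of_nonneg _ _ hp.le, ← ENNReal.rpow_mul, ← ENNReal.rpow_mul,
            ← ENNReal.rpow_mul, ← ENNReal.rpow_mul, one_div_mul_cancel hp.ne', ENNReal.rpow_one,
            ← mul_assoc q, mul_one_div_cancel hq.ne', one_mul, one_div_mul_eq_div,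
            mul_assoc]
      _ = _ := by
          rw [lintegral_const_mul' _ _ (ENNReal.rpow_ne_top_of_nonneg hp.le hxt)]
  have hm : AEMeasurable (Function.uncurry fun x y =>
      φ x ^ p * (K (x, y) * (φ y ^ (-p) * f y ^ p))) (ν.prod ν) :=
    (((hφ.pow_const _).comp measurable_fst).aemeasurable).mul (hK.aemeasurable.mul
      ((((hφ.pow_const _).comp measurable_snd).aemeasurable).mul (hf.comp_snd.pow_const _)))
  calc _ ≤ ∫⁻ x, A ^ (p / q) * ∫⁻ y, φ x ^ p * (K (x, y) * (φ y ^ (-p) * f y ^ p)) ∂ν ∂ν :=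
        lintegral_mono_ae hpt
    _ = A ^ (p / q) * ∫⁻ y, ∫⁻ x, φ x ^ p * (K (x, y) * (φ y ^ (-p) * f y ^ p)) ∂ν ∂ν := by
        rw [← lintegral_lintegral_swap hm]
        exact lintegral_const_mul'' _ hm.lintegral_prod_right'
    _ ≤ A ^ (p / q) * ∫⁻ y, B * f y ^ p ∂ν := by
        refine mul_le_mul' le_rfl (lintegral_mono_ae ?_)
        filter_upwards [hB, hφ0, hφt] with y hy hy0 hyt
        calc ∫⁻ x, φ x ^ p * (K (x, y) * (φ y ^ (-p) * f y ^ p)) ∂ν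
            = ∫⁻ x, (K (x, y) * φ x ^ p) * (φ y ^ (-p) * f y ^ p) ∂ν :=
              lintegral_congr fun x => by ring
          _ = (∫⁻ x, K (x, y) * φ x ^ p ∂ν) * (φ y ^ (-p) * f y ^ p) :=
              lintegral_mul_const _ ((hK.comp measurable_prodMk_right).mul (hφ.pow_const _))
          _ ≤ (B * φ y ^ p) * (φ y ^ (-p) * f y ^ p) := mul_le_mul' hy le_rfl
          _ = B * f y ^ p := by
              rw [ENNReal.rpow_neg, mul_assoc, ← mul_assoc (φ y ^ p), ENNReal.mul_inv_cancel
                (ENNReal.rpow_pos (pos_iff_ne_zero.2 hy0) hyt).ne'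
                (ENNReal.rpow_ne_top_of_nonneg hp.le hyt), one_mul]
    _ = _ := by rw [lintegral_const_mul'' _ (hf.pow_const _), mul_assoc]

/-! ### The Forelli–Rudin estimate on the ball -/

section ForelliRudin

/-- The weight `(1 - |z|²)^(-ε)` on the unit ball. -/
def ballWeight {m : ℕ} (ε : ℝ) (z : Fin m → ℂ) : ℝ≥0∞ :=
  ENNReal.ofReal ((1 - ∑ i, ‖z i‖ ^ 2) ^ (-ε))

theorem measurable_ballWeight {m : ℕ} (ε : ℝ) : Measurable (ballWeight (m := m) ε) := by
  unfold ballWeight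
  fun_prop

theorem ballWeight_ne_zero {m : ℕ} (ε : ℝ) {z : Fin m → ℂ} (hz : z ∈ unitBall m) :
    ballWeight ε z ≠ 0 := by
  have h : 0 < 1 - ∑ i, ‖z i‖ ^ 2 := sub_pos.2 hz
  exact (ENNReal.ofReal_pos.2 (Real.rpow_pos_of_pos h _)).ne'

theorem ballWeight_rpow {m : ℕ} (ε s : ℝ) {z : Fin m → ℂ} (hz : z ∈ unitBall m) :
    ballWeight ε z ^ s = ballWeight (ε * s) z := by
  have h : 0 < 1 - ∑ i, ‖z i‖ ^ 2 := sub_pos.2 hz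
  rw [ballWeight, ENNReal.ofReal_rpow_of_pos (Real.rpow_pos_of_pos h _), ← Real.rpow_mul h.le,
    neg_mul, ballWeight]

/-- In slice coordinates the defining function factors: `1 - |ζ|² = (1 - |a|²)(1 - |b|²)`. -/
theorem ballWeight_sliceMap {k : ℕ} (ε : ℝ) {b : Fin k → ℂ} (hb : b ∈ unitBall k) {a : ℂ}
    (ha : ‖a‖ < 1) : ballWeight ε (sliceMap k (b, a)) =
      ENNReal.ofReal ((1 - ‖a‖ ^ 2) ^ (-ε)) * ballWeight ε b := by
  have hb' : 0 < 1 - ∑ i, ‖b i‖ ^ 2 := sub_pos.2 hb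
  have ha' : 0 < 1 - ‖a‖ ^ 2 := sub_pos.2 ((sq_lt_one_iff₀ (norm_nonneg _)).2 ha)
  have e : 1 - ∑ i, ‖sliceMap k (b, a) i‖ ^ 2 = (1 - ‖a‖ ^ 2) * (1 - ∑ i, ‖b i‖ ^ 2) := by
    simp only [sliceMap, sum_norm_sq_cons, sum_norm_sq_smul, norm_sliceRadius_sq ha]
    ring
  rw [ballWeight, e, Real.mul_rpow ha'.le hb'.le, ENNReal.ofReal_mul (by positivity), ballWeight]

/-- Since `1 - |a|² ≤ 2 |1 - r a|`, the weight `(1 - |a|²)^k` absorbs `k` powers of the kernel at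
the cost of `2^k`, leaving the unweighted disc estimate. -/
theorem discWeight_mul_kernel_le {k : ℕ} {ε r : ℝ} (hr0 : 0 ≤ r) (hr : r < 1) {a : ℂ}
    (ha : ‖a‖ < 1) :
    ENNReal.ofReal ((1 - ‖a‖ ^ 2) ^ k) * (‖((1 - r * conj a) ^ (k + 2) : ℂ)⁻¹‖ₑ *
      ENNReal.ofReal ((1 - ‖a‖ ^ 2) ^ (-ε))) ≤
    2 ^ k * ENNReal.ofReal ((‖(1 - r * a : ℂ)‖ ^ 2)⁻¹ * (1 - ‖a‖ ^ 2) ^ (-ε)) := by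
  have hn : ‖(1 - r * conj a : ℂ)‖ = ‖(1 - r * a : ℂ)‖ := by
    rw [← RCLike.norm_conj]
    simp
  have h0 : 0 < ‖(1 - r * a : ℂ)‖ := norm_pos_iff.2 (one_sub_mul_ne_zero hr0 hr ha)
  have ha' : 0 < 1 - ‖a‖ ^ 2 := sub_pos.2 ((sq_lt_one_iff₀ (norm_nonneg _)).2 ha)
  have h1 : 1 - ‖a‖ ^ 2 ≤ 2 * ‖(1 - r * a : ℂ)‖ := by
    have h2 := norm_sub_norm_le (1 : ℂ) (r * a)
    rw [norm_one, norm_mul, Complex.norm_real, Real.norm_of_nonneg hr0] at h2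
    nlinarith [norm_nonneg a, mul_le_of_le_one_left (norm_nonneg a) hr.le]
  have hw : 0 ≤ (1 - ‖a‖ ^ 2) ^ (-ε) := Real.rpow_nonneg ha'.le _
  have e2 : (2 : ℝ≥0∞) ^ k = ENNReal.ofReal (2 ^ k) := by
    rw [ENNReal.ofReal_pow (by norm_num)]; simp
  rw [← ofReal_norm, norm_inv, norm_pow, hn, ← ENNReal.ofReal_mul (by positivity),
    ← ENNReal.ofReal_mul (by positivity), e2, ← ENNReal.ofReal_mul (by positivity)]
  refine ENNReal.ofReal_le_ofReal ?_
  calc (1 - ‖a‖ ^ 2) ^ k * ((‖(1 - r * a : ℂ)‖ ^ (k + 2))⁻¹ * (1 - ‖a‖ ^ 2) ^ (-ε))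
      ≤ (2 * ‖(1 - r * a : ℂ)‖) ^ k * ((‖(1 - r * a : ℂ)‖ ^ (k + 2))⁻¹ * (1 - ‖a‖ ^ 2) ^ (-ε)) := by
        gcongr
    _ = _ := by
        rw [mul_pow, pow_add]
        field_simp

/-- On the first axis the integrand splits in slice coordinates into a function of `a` times the
weight in `b`. The latter integrates to a finite constant by hypothesis, the former is the disc
estimate. -/
theorem exists_lintegral_single_le {k : ℕ} {ε : ℝ} (hε0 : 0 < ε) (hε1 : ε < 1)
    (hk : ∫⁻ b in unitBall k, ballWeight ε b ≠ ∞) : ∃ C : ℝ≥0∞, C ≠ ∞ ∧ ∀ r : ℝ, 0 ≤ r → r < 1 →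
      ∫⁻ ζ in unitBall (k + 1), ‖ballKernel (Pi.single 0 (r : ℂ)) ζ‖ₑ * ballWeight ε ζ ≤
        C * ENNReal.ofReal ((1 - r ^ 2) ^ (-ε)) := by
  set I := ∫⁻ b in unitBall k, ballWeight ε b
  -- The factor `2 ^ ε` pays for replacing `1 - r` by `1 - r²`, as `(1 - r²) / 2 ≤ 1 - r`.
  set M : ℝ := 2 * Real.pi * (1 / (1 - ε) + 1 / ε) * 2 ^ ε
  have hM : 0 ≤ M := by
    have := Real.pi_pos
    have : 0 < 1 - ε := by linarith
    positivity
  refine ⟨2 ^ k * ENNReal.ofReal M * I, ENNReal.mul_ne_top (ENNReal.mul_ne_top (by simp)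
    ENNReal.ofReal_ne_top) hk, fun r hr0 hr => ?_⟩
  have hs := measurePreserving_sliceMap k
  have hm : Measurable fun ζ : Fin (k + 1) → ℂ =>
      ‖ballKernel (Pi.single 0 (r : ℂ)) ζ‖ₑ * ballWeight ε ζ :=
    (measurable_ballKernel_right _).enorm.mul (measurable_ballWeight ε)
  have hmq : Measurable fun a : ℂ => ‖((1 - r * conj a) ^ (k + 2) : ℂ)⁻¹‖ₑ *
      ENNReal.ofReal ((1 - ‖a‖ ^ 2) ^ (-ε)) := by
    have hc : Continuous fun a : ℂ => ((1 - r * conj a) ^ (k + 2) : ℂ) := by fun_prop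
    exact hc.measurable.inv.enorm.mul (Measurable.ennreal_ofReal (by fun_prop))
  have hδ : (1 - r) ^ (-ε) ≤ 2 ^ ε * (1 - r ^ 2) ^ (-ε) := by
    have h1 : 0 < 1 - r ^ 2 := by nlinarith
    calc (1 - r) ^ (-ε) ≤ ((1 - r ^ 2) / 2) ^ (-ε) :=
          Real.rpow_le_rpow_of_nonpos (by positivity) (by nlinarith) (by linarith)
      _ = _ := by
          rw [Real.div_rpow h1.le zero_le_two, Real.rpow_neg zero_le_two, div_inv_eq_mul, mul_comm]
  have hms : Measurable fun x : (Fin k → ℂ) × ℂ =>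
      ‖ballKernel (Pi.single 0 (r : ℂ)) (sliceMap k x)‖ₑ * ballWeight ε (sliceMap k x) :=
    hm.comp hs.measurable
  rw [← hs.lintegral_comp hm, lintegral_prod_symm' _ hms]
  calc _ = ∫⁻ a, (‖((1 - r * conj a) ^ (k + 2) : ℂ)⁻¹‖ₑ *
        ENNReal.ofReal ((1 - ‖a‖ ^ 2) ^ (-ε))) * I ∂discMeasure k := by
        refine lintegral_congr_ae ?_
        filter_upwards [ae_discMeasure_mem k] with a ha
        rw [mem_ball_zero_iff] at ha
        rw [← lintegral_const_mul' _ _ (ENNReal.mul_ne_top enorm_ne_top ENNReal.ofReal_ne_top)]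
        refine lintegral_congr_ae ?_
        filter_upwards [ae_restrict_mem (isOpen_unitBall k).measurableSet] with b hb
        rw [ballKernel_single_sliceMap, ballWeight_sliceMap ε hb ha, mul_assoc]
    _ = (∫⁻ a in Metric.ball (0 : ℂ) 1, ENNReal.ofReal ((1 - ‖a‖ ^ 2) ^ k) *
        (‖((1 - r * conj a) ^ (k + 2) : ℂ)⁻¹‖ₑ * ENNReal.ofReal ((1 - ‖a‖ ^ 2) ^ (-ε)))) * I := by
        rw [lintegral_mul_const _ hmq, lintegral_discMeasure k hmq]
    _ ≤ (∫⁻ a in Metric.ball (0 : ℂ) 1, 2 ^ k *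
        ENNReal.ofReal ((‖(1 - r * a : ℂ)‖ ^ 2)⁻¹ * (1 - ‖a‖ ^ 2) ^ (-ε))) * I := by
        refine mul_le_mul' (setLIntegral_mono' Metric.isOpen_ball.measurableSet fun a ha => ?_) le_rfl
        exact discWeight_mul_kernel_le hr0 hr (mem_ball_zero_iff.1 ha)
    _ ≤ 2 ^ k * ENNReal.ofReal (M * (1 - r ^ 2) ^ (-ε)) * I := by
        rw [lintegral_const_mul' _ _ (by simp)]
        refine mul_le_mul' (mul_le_mul' le_rfl ((lintegral_disc_le hε0 hε1 hr0 hr).trans ?_)) le_rfl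
        refine ENNReal.ofReal_le_ofReal ?_
        have := Real.pi_pos
        have : 0 < 1 - ε := by linarith
        calc _ ≤ 2 * Real.pi * ((1 / (1 - ε) + 1 / ε) * (2 ^ ε * (1 - r ^ 2) ^ (-ε))) := by gcongr
          _ = _ := by ring
    _ = _ := by
        rw [ENNReal.ofReal_mul hM]
        ring

/-- Induction on the dimension: at `r = 0` the kernel is `1`, so the preceding estimate in dimension
`k + 1` is the claim itself. -/
theorem lintegral_ballWeight_ne_top (k : ℕ) {ε : ℝ} (hε0 : 0 < ε) (hε1 : ε < 1) :
    ∫⁻ b in unitBall k, ballWeight ε b ≠ ∞ := by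
  induction k with
  | zero => simp [ballWeight]
  | succ k ih =>
    obtain ⟨C, hC, h⟩ := exists_lintegral_single_le hε0 hε1 ih
    have h0 := h 0 le_rfl one_pos
    simp only [Complex.ofReal_zero, Pi.single_zero, ballKernel, zero_dotProduct, sub_zero, one_pow,
      inv_one, enorm_one, one_mul] at h0
    refine ne_top_of_le_ne_top (ENNReal.mul_ne_top hC ENNReal.ofReal_ne_top) h0

/-- The Forelli–Rudin estimate for the unit ball. -/
theorem exists_lintegral_ballKernel_le (m : ℕ) {ε : ℝ} (hε0 : 0 < ε) (hε1 : ε < 1) :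
    ∃ C : ℝ≥0∞, C ≠ ∞ ∧ ∀ z ∈ unitBall m,
      ∫⁻ ζ in unitBall m, ‖ballKernel z ζ‖ₑ * ballWeight ε ζ ≤ C * ballWeight ε z := by
  cases m with
  | zero =>
    refine ⟨volume (unitBall 0), volume_unitBall_ne_top 0, fun z _ => ?_⟩
    simp [ballKernel, ballWeight]
  | succ k =>
    obtain ⟨C, hC, h⟩ := exists_lintegral_single_le hε0 hε1 (lintegral_ballWeight_ne_top k hε0 hε1)
    refine ⟨C, hC, fun z hz => ?_⟩
    obtain ⟨U, hU, hUz⟩ := exists_unitary_mulVec_single z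
    have h1 := h _ (Real.sqrt_nonneg _) (sqrt_sum_lt_one hz)
    rw [Real.sq_sqrt (by positivity)] at h1
    refine le_trans (le_of_eq ?_) h1
    have hm : Measurable fun ζ => ‖ballKernel z ζ‖ₑ * ballWeight ε ζ :=
      (measurable_ballKernel_right z).enorm.mul (measurable_ballWeight ε)
    rw [← (measurePreserving_mulVec_unitBall hU).lintegral_comp hm]
    refine lintegral_congr fun v => ?_
    have e1 : ballKernel z (U.mulVec v) =
        ballKernel (Pi.single 0 (Real.sqrt (∑ i, ‖z i‖ ^ 2) : ℂ)) v := by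
      conv_lhs => rw [← hUz]
      exact ballKernel_mulVec hU _ _
    have e2 : ballWeight ε (U.mulVec v) = ballWeight ε v := by
      simp only [ballWeight, sum_norm_sq_mulVec hU]
    simp only [e1, e2]

end ForelliRudin

/-! ### The Bergman projection of the ball -/

section BallProjection

variable {m : ℕ}

theorem measurable_ballKernel_left (z : Fin m → ℂ) : Measurable fun ζ => ballKernel ζ z :=
  Measurable.comp (g := fun x : (Fin m → ℂ) × (Fin m → ℂ) => ballKernel x.1 x.2)
    (f := fun ζ => (ζ, z)) measurable_ballKernel measurable_prodMk_right

theorem differentiableOn_ballKernel_left {z : Fin m → ℂ} (hz : z ∈ unitBall m) :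
    DifferentiableOn ℂ (fun ζ => ballKernel ζ z) (unitBall m) := by
  unfold ballKernel
  refine DifferentiableOn.inv (DifferentiableOn.pow ?_ _) fun ζ hζ => ?_
  · unfold dotProduct
    fun_prop
  · refine pow_ne_zero _ (norm_pos_iff.1 ?_)
    exact (sub_pos.2 (sqrt_sum_lt_one hζ)).trans_le (one_sub_sqrt_le_norm ζ hz)

/-- The Bergman projection of the unit ball is given by the Bergman kernel. -/
theorem IsBergmanProj.ae_eq_integral_ballKernel {f g : (Fin m → ℂ) → ℂ}
    (h : IsBergmanProj (unitBall m) (volume.restrict (unitBall m)) f g) :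
    ∀ᵐ z ∂volume.restrict (unitBall m), volume.real (unitBall m) * g z =
      ∫ ζ in unitBall m, f ζ * ballKernel z ζ := by
  have hL2 : ∀ z ∈ unitBall m, MemLp (ballKernel z) 2 (volume.restrict (unitBall m)) :=
    fun z hz => (memLp_top_ballKernel hz).mono_exponent le_top
  -- The kernel is conjugate holomorphic in `ζ`, hence does not see `f - g`.
  have hfg : ∀ z ∈ unitBall m, ∫ ζ in unitBall m, f ζ * ballKernel z ζ =
      ∫ ζ in unitBall m, g ζ * ballKernel z ζ := by
    intro z hz
    have h1 := h.orth (F := fun ζ => ballKernel ζ z) (differentiableOn_ballKernel_left hz) (by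
      refine (hL2 z hz).star.congr_norm ?_ (Eventually.of_forall fun ζ => ?_)
      · exact (measurable_ballKernel_left z).aestronglyMeasurable
      · rw [Pi.star_apply, norm_star, norm_ballKernel_comm])
    have h2 := congrArg conj h1
    rw [map_zero, ← integral_conj] at h2
    simp only [map_mul, ballKernel_conj, Complex.conj_conj] at h2
    rw [← sub_eq_zero, ← integral_sub (integrable_mul_ballKernel hz (h.left.integrable one_le_two))
      (integrable_mul_ballKernel hz (h.right.integrable one_le_two)), ← h2]
    exact integral_congr_ae (Eventually.of_forall fun ζ => by simp only; ring)
  obtain ⟨F, hF, hF2, hlim⟩ := h.approx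
  obtain ⟨ns, hns, hae⟩ := (tendstoInMeasure_of_tendsto_eLpNorm two_ne_zero
    (fun k => (hF2 k).1) h.right.1 hlim).exists_seq_tendsto_ae
  filter_upwards [hae, ae_restrict_mem (isOpen_unitBall m).measurableSet] with z hz hzB
  rw [hfg z hzB]
  -- The holomorphic approximants satisfy the reproducing formula pointwise. Their kernel integrals
  -- converge by Hölder, their values almost everywhere along the subsequence.
  have h1 : Tendsto (fun k => ∫ ζ in unitBall m, F (ns k) ζ * ballKernel z ζ) atTop
      (𝓝 (∫ ζ in unitBall m, g ζ * ballKernel z ζ)) := by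
    refine tendsto_integral_of_L1' _
      (integrable_mul_ballKernel hzB (h.right.integrable one_le_two)).1
      (Eventually.of_forall fun k => integrable_mul_ballKernel hzB
        ((hF2 (ns k)).integrable one_le_two)) ?_
    have hb : ∀ k, eLpNorm ((fun ζ => F (ns k) ζ * ballKernel z ζ) -
        fun ζ => g ζ * ballKernel z ζ) 1 (volume.restrict (unitBall m)) ≤
        eLpNorm (F (ns k) - g) 2 (volume.restrict (unitBall m)) *
          eLpNorm (ballKernel z) 2 (volume.restrict (unitBall m)) := by
      intro k
      have e : ((fun ζ => F (ns k) ζ * ballKernel z ζ) - fun ζ => g ζ * ballKernel z ζ) =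
          (F (ns k) - g) • ballKernel z := by
        ext ζ
        simp only [Pi.sub_apply, Pi.smul_apply', smul_eq_mul]
        ring
      rw [e]
      exact eLpNorm_smul_le_mul_eLpNorm (hL2 z hzB).1 ((hF2 _).1.sub h.right.1)
    have hl := ENNReal.Tendsto.mul_const (hlim.comp hns.tendsto_atTop)
      (Or.inr (hL2 z hzB).2.ne)
    rw [zero_mul] at hl
    exact tendsto_of_tendsto_of_tendsto_of_le_of_le tendsto_const_nhds hl (fun _ => zero_le) hb
  have h2 : ∀ k, ∫ ζ in unitBall m, F (ns k) ζ * ballKernel z ζ =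
      volume.real (unitBall m) * F (ns k) z := fun k =>
    integral_mul_ballKernel hzB (hF _) ((hF2 _).integrable one_le_two)
  simp_rw [h2] at h1
  exact tendsto_nhds_unique (hz.const_mul _) h1

/-- Schur test with `φ = (1 - |z|²)^(-1/(pq))`. Then `φ^q` and `φ^p` are the weights of exponents
`1/p` and `1/q`, both in `(0, 1)`, which is the range of the Forelli–Rudin estimate. -/
theorem isLpBdd_unitBall (m : ℕ) {p : ℝ} (hp : 1 < p) :
    IsLpBdd (unitBall m) (volume.restrict (unitBall m)) p := by
  have hpq := Real.HolderConjugate.conjExponent hp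
  set q := p.conjExponent
  have hq : 1 < q := hpq.symm.lt
  have hp0 := hpq.pos
  have hq0 := hpq.symm.pos
  obtain ⟨A, hA, hA'⟩ := exists_lintegral_ballKernel_le m (ε := 1 / p) (by positivity)
    ((div_lt_one hp0).2 hp)
  obtain ⟨B, hB, hB'⟩ := exists_lintegral_ballKernel_le m (ε := 1 / q) (by positivity)
    ((div_lt_one hq0).2 hq)
  have hmem := ae_restrict_mem (μ := volume) (isOpen_unitBall m).measurableSet
  have hv0 : ENNReal.ofReal (volume.real (unitBall m)) ≠ 0 := by
    rw [Measure.real, ENNReal.ofReal_toReal (volume_unitBall_ne_top m)]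
    exact volume_unitBall_ne_zero m
  set v := ENNReal.ofReal (volume.real (unitBall m))
  have ep : 1 / (p * q) * p = 1 / q := by field_simp
  have eq : 1 / (p * q) * q = 1 / p := by field_simp
  have hconst : (A ^ (p / q) * B) / v ^ p ≠ ∞ :=
    ENNReal.div_ne_top (ENNReal.mul_ne_top (ENNReal.rpow_ne_top_of_nonneg (by positivity) hA) hB)
      (ENNReal.rpow_pos (pos_iff_ne_zero.2 hv0) ENNReal.ofReal_ne_top).ne'
  -- The division by `v ^ p` compensates for `ballKernel` lacking the factor `1 / vol(B)` of the
  -- true Bergman kernel.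
  refine ⟨(((A ^ (p / q) * B) / v ^ p) ^ (1 / p)).toNNReal, fun f g hfg _ => ?_⟩
  rw [eLpNorm_ofReal_le_iff hp0, ENNReal.coe_toNNReal
    (ENNReal.rpow_ne_top_of_nonneg (by positivity) hconst), ← ENNReal.rpow_mul, one_div,
    inv_mul_cancel₀ hp0.ne', ENNReal.rpow_one]
  have hschur := lintegral_schur_test (ν := volume.restrict (unitBall m))
    (K := fun x : (Fin m → ℂ) × (Fin m → ℂ) => ‖ballKernel x.1 x.2‖ₑ) measurable_ballKernel.enorm
    hpq (measurable_ballWeight (1 / (p * q)))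
    (hmem.mono fun z hz => ballWeight_ne_zero _ hz)
    (Eventually.of_forall fun z => ENNReal.ofReal_ne_top) (A := A) (B := B)
    (by
      filter_upwards [hmem] with z hz
      rw [ballWeight_rpow _ _ hz, eq]
      refine le_trans (le_of_eq (lintegral_congr_ae ?_)) (hA' z hz)
      filter_upwards [hmem] with ζ hζ
      rw [ballWeight_rpow _ _ hζ, eq])
    (by
      filter_upwards [hmem] with z hz
      rw [ballWeight_rpow _ _ hz, ep]
      refine le_trans (le_of_eq (lintegral_congr_ae ?_)) (hB' z hz)
      filter_upwards [hmem] with ζ hζ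
      rw [ballWeight_rpow _ _ hζ, ep, ← ofReal_norm, ← ofReal_norm (ballKernel z ζ),
        norm_ballKernel_comm])
    hfg.left.1.enorm
  have hpt : ∀ᵐ z ∂volume.restrict (unitBall m), v * ‖g z‖ₑ ≤
      ∫⁻ ζ in unitBall m, ‖ballKernel z ζ‖ₑ * ‖f ζ‖ₑ := by
    filter_upwards [hfg.ae_eq_integral_ballKernel] with z hz
    have e : v * ‖g z‖ₑ = ‖(volume.real (unitBall m) : ℂ) * g z‖ₑ := by
      rw [enorm_mul, ← ofReal_norm ((volume.real (unitBall m) : ℂ)), Complex.norm_real,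
        Real.norm_of_nonneg measureReal_nonneg]
    rw [e, hz]
    refine (enorm_integral_le_lintegral_enorm _).trans (le_of_eq (lintegral_congr fun ζ => ?_))
    rw [enorm_mul, mul_comm]
  have hfin : v ^ p * ∫⁻ z in unitBall m, ‖g z‖ₑ ^ p ≤
      A ^ (p / q) * B * ∫⁻ z in unitBall m, ‖f z‖ₑ ^ p := by
    rw [← lintegral_const_mul' _ _ (ENNReal.rpow_ne_top_of_nonneg hp0.le ENNReal.ofReal_ne_top)]
    refine le_trans (lintegral_mono_ae ?_) hschur
    filter_upwards [hpt] with z hz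
    rw [← ENNReal.mul_rpow_of_nonneg _ _ hp0.le]
    exact ENNReal.rpow_le_rpow hz hp0.le
  rw [div_eq_mul_inv, mul_right_comm, ← div_eq_mul_inv, ENNReal.le_div_iff_mul_le
    (Or.inl (ENNReal.rpow_pos (pos_iff_ne_zero.2 hv0) ENNReal.ofReal_ne_top).ne')
    (Or.inl (ENNReal.rpow_ne_top_of_nonneg hp0.le ENNReal.ofReal_ne_top)), mul_comm]
  exact hfin

end BallProjection

end WeightedBergman

end

/-! ### The inflation principle -/

theorem proposition2p5 (m n : ℕ) (Ω : Set (Fin n → ℂ)) (hΩ_open : IsOpen Ω)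
    (hΩ_conn : IsConnected Ω) (g : (Fin n → ℂ) → ℂ) (hg : DifferentiableOn ℂ g Ω)
    (hg_ne : ∀ w ∈ Ω, g w ≠ 0) (μ : (Fin n → ℂ) → ℝ) (hμ : ∀ w ∈ Ω, μ w = ‖g w‖ ^ 2)
    (lam : (Fin n → ℂ) → ℝ) (hlam : ContinuousOn lam Ω) (hlam_pos : ∀ w ∈ Ω, 0 < lam w)
    (p : ℝ) (hp : 1 < p) :
    WeightedBergman.IsLpBounded (WeightedBergman.inflation m Ω μ) (fun x => lam x.2) p ↔
      WeightedBergman.IsLpBounded Ω (fun w => μ w ^ m * lam w) p := by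
  rw [WeightedBergman.isLpBounded_inflation_iff hΩ_open hg hg_ne hμ hlam,
    WeightedBergman.isLpBounded_iff_isLpBdd]
  have hB := ae_restrict_mem (μ := volume) (WeightedBergman.isOpen_unitBall m).measurableSet
  have hW := WeightedBergman.ae_weightedMeasure_mem hΩ_open.measurableSet fun w => μ w ^ m * lam w
  have h0 : volume.restrict (WeightedBergman.unitBall m) ≠ 0 :=
    Measure.restrict_eq_zero.not.2 (WeightedBergman.volume_unitBall_ne_zero m)
  exact ⟨fun h => h.of_prod h0 hB hW hp, fun h => .prod hB hW hp
    (WeightedBergman.isLpBdd_unitBall m hp) h⟩
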